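/- Let $a<b<c$ be natural numbers with $\gcd(a,b,c)=1$ such that the numbers $a^pb^qc^l$, $(p,q,l)\in\mathbb{N}_0^3$, are pairwise distinct (this forces $a>1$, and it holds for instance when $a>1$ and $a,b,c$ are pairwise coprime). Put $$N_{a,b,c}(x)=\#\{(p,q,l)\in\mathbb{N}_0^3 : a^pb^qc^l\le x\},\qquad S_{a,b,c}=\{a^pb^qc^l : p,q,l\in\mathbb{N}_0\},$$ let $\chi_{S_{a,b,c}}$ be the characteristic function of $S_{a,b,c}$, and let $B_1^*(\{y\})=\{y\}-\frac12$ if $y\notin\mathbb{Z}$ and $B_1^*(\{y\})=0$ if $y\in\mathbb{Z}$, where $\{y\}$ is the fractional part of $y$. Then for every real $x\ge 1$ $$\begin{aligned} N_{a,b,c}(x)={}&\frac{\log(x)^3}{6\log a\log b\log c}+\frac{\log(x)^2}{4\log a\log b}+\frac{\log(x)^2}{4\log a\log c}+\frac{\log(x)^2}{4\log b\log c}\\ &+\frac{\log x}{4\log a}+\frac{\log x}{4\log b}+\frac{\log x}{4\log c}+\frac{\log a\log x}{12\log b\log c}+\frac{\log b\log x}{12\log a\log c}+\frac{\log c\log x}{12\log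 a\log b}\\ &+\frac{\log a}{24\log b}+\frac{\log a}{24\log c}+\frac{\log b}{24\log a}+\frac{\log b}{24\log c}+\frac{\log c}{24\log a}+\frac{\log c}{24\log b}+\frac18\\ &-B_1^*\left(\left\{\tfrac{\log x}{\log a}\right\}\right)-B_1^*\left(\left\{\tfrac{\log x}{\log b}\right\}\right)-B_1^*\left(\left\{\tfrac{\log x}{\log c}\right\}\right)\\ &-\frac{1}{4\pi}\bigl(C_{a,b}+C_{b,c}+C_{a,c}\bigr)-\frac{1}{8\pi}D+\frac12\chi_{S_{a,b,c}}(x). \end{aligned}$$ Here the series $C_{u,v}$ and $D$ are the limits $$C_{u,v}=\lim_{R\to\infty}\left(\sum_{k=1}^{\lfloor R\log u\rfloor}\frac{\cos\left(2\pi k\frac{\log x-\frac12\log v}{\log u}\right)}{k\sin\left(\frac{\pi k\log v}{\log u}\right)}+\sum_{k=1}^{\lfloor R\log v\rfloor}\frac{\cos\left(2\pi k\frac{\log x-\frac12\log u}{\log v}\right)}{k\sin\left(\frac{\pi k\log u}{\log v}\right)}\right),$$ $$D=\lim_{R\to\infty}\bigl(D_{a;b,c}(R)+D_{b;a,c}(R)+D_{c;a,b}(R)\bigr),$$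 $$D_{u;v,w}(R)=\sum_{k=1}^{\lfloor R\log u\rfloor}\frac{\sin\left(2\pi k\frac{\log x+\frac12\log v-\frac12\log w}{\log u}\right)+\sin\left(2\pi k\frac{\log x-\frac12\log v+\frac12\log w}{\log u}\right)}{k\sin\left(\frac{\pi k\log v}{\log u}\right)\sin\left(\frac{\pi k\log w}{\log u}\right)}.$$ All these limits exist when $R\to\infty$ in the following manner: for every fixed $\delta$ with $0<\delta<\frac16$, the real numbers $R$ for which $R\log a$, $R\log b$ and $R\log c$ all have distance at least $\delta$ from the nearest integer are unbounded above, the limits exist as $R\to\infty$ through these $R$, and they do not depend on $\delta$. -/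

import Mathlib

open Filter Topology

noncomputable section

/-- The number of triples `(p, q, l)` of natural numbers (zero included) with
`a ^ p * b ^ q * c ^ l ≤ x`. -/
def countN (a b c : ℕ) (x : ℝ) : ℕ :=
  Set.ncard {t : ℕ × ℕ × ℕ | (a : ℝ) ^ t.1 * (b : ℝ) ^ t.2.1 * (c : ℝ) ^ t.2.2 ≤ x}

/-- The set of numbers of the form `a ^ p * b ^ q * c ^ l`, as a set of reals. -/
def smoothSet (a b c : ℕ) : Set ℝ :=
  {y : ℝ | ∃ p q l : ℕ, y = (a : ℝ) ^ p * (b : ℝ) ^ q * (c : ℝ) ^ l}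

/-- The characteristic function of `smoothSet a b c`. -/
def chiS (a b c : ℕ) (x : ℝ) : ℝ := (smoothSet a b c).indicator (fun _ => 1) x

open Classical in
/-- The function `y ↦ B₁*({y})`: it is `{y} - 1/2` if `y` is not an integer and `0` if it is. -/
def B1star (y : ℝ) : ℝ := if ∃ n : ℤ, y = n then 0 else Int.fract y - 1 / 2

/-- The partial sum over `1 ≤ k ≤ ⌊R log a⌋` of the cosine series with base `a` and second
base `b`. -/
def cosSum (x : ℝ) (a b : ℕ) (R : ℝ) : ℝ :=
  ∑ k ∈ Finset.Icc 1 ⌊R * Real.log a⌋₊,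
    Real.cos (2 * Real.pi * k * ((Real.log x - 1 / 2 * Real.log b) / Real.log a)) /
      (k * Real.sin (Real.pi * k * Real.log b / Real.log a))

/-- The partial sum of the paired cosine series of the bases `a` and `b`: both sums are cut
with the same `R`. -/
def cosPairSum (x : ℝ) (a b : ℕ) (R : ℝ) : ℝ := cosSum x a b R + cosSum x b a R

/-- The partial sum over `1 ≤ k ≤ ⌊R log a⌋` of the sine series with base `a` and the two
other bases `b` and `c`. -/
def sinSum (x : ℝ) (a b c : ℕ) (R : ℝ) : ℝ :=
  ∑ k ∈ Finset.Icc 1 ⌊R * Real.log a⌋₊,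
    (Real.sin (2 * Real.pi * k *
        ((Real.log x + 1 / 2 * Real.log b - 1 / 2 * Real.log c) / Real.log a)) /
      (k * Real.sin (Real.pi * k * Real.log b / Real.log a) *
        Real.sin (Real.pi * k * Real.log c / Real.log a)) +
     Real.sin (2 * Real.pi * k *
        ((Real.log x - 1 / 2 * Real.log b + 1 / 2 * Real.log c) / Real.log a)) /
      (k * Real.sin (Real.pi * k * Real.log b / Real.log a) *
        Real.sin (Real.pi * k * Real.log c / Real.log a)))

/-- `R → ∞` in such a manner that `R log a`, `R log b` and `R log c` all stay at distance at
least `δ` from the integers. -/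
def gapFilter (a b c : ℕ) (δ : ℝ) : Filter ℝ :=
  atTop ⊓ 𝓟 {R : ℝ | ∀ n : ℤ, δ ≤ |R * Real.log a - n| ∧ δ ≤ |R * Real.log b - n| ∧
    δ ≤ |R * Real.log c - n|}

end

/-
By Perron's formula, the number of `n : ι → ℕ` with `∑ᵢ nᵢ αᵢ ≤ L`, boundary points counted half,
is the integral of `e^{Ls} / s · ∏ᵢ (1 - e^{-αᵢ s})⁻¹` along the line `Re s = 1`, divided by `2πi`.
Push the line to `-∞`: the pole at `0` contributes a polynomial in `L`, and the poles `2πik / αᵢ`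
with `k ≠ 0`, which are simple because the ratios `αᵢ / αⱼ` are irrational, contribute
trigonometric series. Along the horizontal sides `|Im s| = 2πR` the integral vanishes as `R → ∞`
with all `R αᵢ` away from the integers, and such `R` exist because they have positive density. For
one, two and three of the weights `log a`, `log b`, `log c` this gives `B₁*`, and two identities
from which, by the addition theorems, the cosine and the sine series of the theorem are recombined.
-/

noncomputable section

open Complex Set MeasureTheory Asymptotics
open scoped Real

section RectangleIntegral

/-- The integral of `f` along the horizontal segment from `u + it` to `v + it`. -/
def horizontalIntegral (f : ℂ → ℂ) (u v t : ℝ) : ℂ := ∫ x in u..v, f (x + t * I)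

/-- The integral of `f`, in the variable `Im s`, along the vertical segment from `x + ib` to
`x + it`; the contour integral is `I` times this. -/
def verticalIntegral (f : ℂ → ℂ) (b t x : ℝ) : ℂ := ∫ y in b..t, f (x + y * I)

/-- The contour integral of `f` along the boundary of the rectangle `[u, v] × [b, t]`, traversed
counterclockwise. -/
def rectIntegral (f : ℂ → ℂ) (u v b t : ℝ) : ℂ :=
  horizontalIntegral f u v b - horizontalIntegral f u v t +
    I * verticalIntegral f b t v - I * verticalIntegral f b t u

/-- The boundary of the rectangle `[u, v] × [b, t]`, as a set. -/
def rectBoundary (u v b t : ℝ) : Set ℂ := (Icc u v ×ℂ Icc b t) \ (Ioo u v ×ℂ Ioo b t)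

variable {f g F : ℂ → ℂ} {u v b t x y : ℝ} {w : ℂ}

lemma horizontalIntegral_eq_sub_of_hasDerivAt
    (hF : ∀ x ∈ uIcc u v, HasDerivAt F (f (x + t * I)) (x + t * I))
    (hf : IntervalIntegrable (fun x : ℝ => f (x + t * I)) volume u v) :
    horizontalIntegral f u v t = F (v + t * I) - F (u + t * I) := by
  refine intervalIntegral.integral_eq_sub_of_hasDerivAt (f := fun x : ℝ => F (x + t * I))
    (fun x hx => ?_) hf
  have h := HasDerivAt.comp x (h₂ := F) (h := fun x : ℝ => (x + t * I : ℂ)) (hF x hx)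
    (ofRealCLM.hasDerivAt.add_const _)
  rwa [ofRealCLM_apply, ofReal_one, mul_one] at h

lemma I_mul_verticalIntegral_eq_sub_of_hasDerivAt
    (hF : ∀ y ∈ uIcc b t, HasDerivAt F (f (x + y * I)) (x + y * I))
    (hf : IntervalIntegrable (fun y : ℝ => f (x + y * I)) volume b t) :
    I * verticalIntegral f b t x = F (x + t * I) - F (x + b * I) := by
  rw [verticalIntegral, ← intervalIntegral.integral_const_mul]
  refine intervalIntegral.integral_eq_sub_of_hasDerivAt (f := fun y : ℝ => F (x + y * I))
    (fun y hy => ?_) (hf.const_mul I)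
  have h := HasDerivAt.comp y (h₂ := F) (h := fun y : ℝ => (x + y * I : ℂ)) (hF y hy)
    ((ofRealCLM.hasDerivAt.mul_const I).const_add _)
  rwa [ofRealCLM_apply, ofReal_one, one_mul, mul_comm] at h

lemma horizontal_mem_rectBoundary (huv : u ≤ v) (hbt : b ≤ t) (hy : y = b ∨ y = t)
    (hx : x ∈ uIcc u v) : (x + y * I : ℂ) ∈ rectBoundary u v b t := by
  rw [uIcc_of_le huv] at hx
  rcases hy with rfl | rfl <;> simpa [rectBoundary, mem_reProdIm] using ⟨hx, hbt⟩

lemma vertical_mem_rectBoundary (huv : u ≤ v) (hbt : b ≤ t) (hx : x = u ∨ x = v)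
    (hy : y ∈ uIcc b t) : (x + y * I : ℂ) ∈ rectBoundary u v b t := by
  rw [uIcc_of_le hbt] at hy
  rcases hx with rfl | rfl <;> simpa [rectBoundary, mem_reProdIm] using ⟨huv, hy⟩

lemma ne_of_mem_rectBoundary {s : ℂ} (hs : s ∈ rectBoundary u v b t)
    (hw : w ∈ Ioo u v ×ℂ Ioo b t) : s ≠ w := fun h => hs.2 (h ▸ hw)

lemma horizontal_intervalIntegrable (huv : u ≤ v) (hbt : b ≤ t)
    (hf : ContinuousOn f (rectBoundary u v b t)) (hy : y = b ∨ y = t) :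
    IntervalIntegrable (fun x : ℝ => f (x + y * I)) volume u v :=
  (hf.comp (by fun_prop) fun _ => horizontal_mem_rectBoundary huv hbt hy).intervalIntegrable

lemma vertical_intervalIntegrable (huv : u ≤ v) (hbt : b ≤ t)
    (hf : ContinuousOn f (rectBoundary u v b t)) (hx : x = u ∨ x = v) :
    IntervalIntegrable (fun y : ℝ => f (x + y * I)) volume b t :=
  (hf.comp (by fun_prop) fun _ => vertical_mem_rectBoundary huv hbt hx).intervalIntegrable

lemma rectIntegral_congr (huv : u ≤ v) (hbt : b ≤ t) (h : EqOn f g (rectBoundary u v b t)) :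
    rectIntegral f u v b t = rectIntegral g u v b t := by
  have hh : ∀ y, (y = b ∨ y = t) → horizontalIntegral f u v y = horizontalIntegral g u v y :=
    fun y hy => intervalIntegral.integral_congr fun _ hx =>
      h (horizontal_mem_rectBoundary huv hbt hy hx)
  have hv : ∀ x, (x = u ∨ x = v) → verticalIntegral f b t x = verticalIntegral g b t x :=
    fun x hx => intervalIntegral.integral_congr fun _ hy =>
      h (vertical_mem_rectBoundary huv hbt hx hy)
  simp only [rectIntegral, hh _ (.inl rfl), hh _ (.inr rfl), hv _ (.inl rfl), hv _ (.inr rfl)]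

lemma rectIntegral_add (huv : u ≤ v) (hbt : b ≤ t) (hf : ContinuousOn f (rectBoundary u v b t))
    (hg : ContinuousOn g (rectBoundary u v b t)) :
    rectIntegral (fun s => f s + g s) u v b t =
      rectIntegral f u v b t + rectIntegral g u v b t := by
  have hh : ∀ y, (y = b ∨ y = t) → horizontalIntegral (fun s => f s + g s) u v y =
      horizontalIntegral f u v y + horizontalIntegral g u v y := fun y hy =>
    intervalIntegral.integral_add (horizontal_intervalIntegrable huv hbt hf hy)
      (horizontal_intervalIntegrable huv hbt hg hy)
  have hv : ∀ x, (x = u ∨ x = v) → verticalIntegral (fun s => f s + g s) b t x =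
      verticalIntegral f b t x + verticalIntegral g b t x := fun x hx =>
    intervalIntegral.integral_add (vertical_intervalIntegrable huv hbt hf hx)
      (vertical_intervalIntegrable huv hbt hg hx)
  simp only [rectIntegral, hh _ (.inl rfl), hh _ (.inr rfl), hv _ (.inl rfl), hv _ (.inr rfl)]
  ring

lemma rectIntegral_const_mul (c : ℂ) (f : ℂ → ℂ) (u v b t : ℝ) :
    rectIntegral (fun s => c * f s) u v b t = c * rectIntegral f u v b t := by
  simp only [rectIntegral, horizontalIntegral, verticalIntegral,
    intervalIntegral.integral_const_mul]
  ring

lemma rectIntegral_sum {κ : Type*} (J : Finset κ) {f : κ → ℂ → ℂ} (huv : u ≤ v) (hbt : b ≤ t)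
    (hf : ∀ j ∈ J, ContinuousOn (f j) (rectBoundary u v b t)) :
    rectIntegral (fun s => ∑ j ∈ J, f j s) u v b t = ∑ j ∈ J, rectIntegral (f j) u v b t := by
  classical
  induction J using Finset.induction_on with
  | empty => simp [rectIntegral, horizontalIntegral, verticalIntegral]
  | insert a J ha ih =>
    rw [Finset.forall_mem_insert] at hf
    simp only [Finset.sum_insert ha]
    rw [rectIntegral_add huv hbt hf.1 (continuousOn_finsetSum _ hf.2), ih hf.2]

lemma rectIntegral_eq_zero_of_hasDerivAt (huv : u ≤ v) (hbt : b ≤ t)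
    (hf : ContinuousOn f (rectBoundary u v b t))
    (hF : ∀ s ∈ rectBoundary u v b t, HasDerivAt F (f s) s) : rectIntegral f u v b t = 0 := by
  have hh : ∀ y : ℝ, (y = b ∨ y = t) →
      horizontalIntegral f u v y = F (v + y * I) - F (u + y * I) := fun y hy =>
    horizontalIntegral_eq_sub_of_hasDerivAt
      (fun _ hx => hF _ (horizontal_mem_rectBoundary huv hbt hy hx))
      (horizontal_intervalIntegrable huv hbt hf hy)
  have hv : ∀ x : ℝ, (x = u ∨ x = v) →
      I * verticalIntegral f b t x = F (x + t * I) - F (x + b * I) := fun x hx =>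
    I_mul_verticalIntegral_eq_sub_of_hasDerivAt
      (fun _ hy => hF _ (vertical_mem_rectBoundary huv hbt hx hy))
      (vertical_intervalIntegrable huv hbt hf hx)
  rw [rectIntegral, hh _ (.inl rfl), hh _ (.inr rfl), hv _ (.inl rfl), hv _ (.inr rfl)]
  ring

lemma continuousOn_sub_zpow (hw : w ∈ Ioo u v ×ℂ Ioo b t) (n : ℤ) :
    ContinuousOn (fun s : ℂ => (s - w) ^ n) (rectBoundary u v b t) := fun _ hs =>
  ((continuousAt_id.sub continuousAt_const).zpow₀ n
    (.inl (sub_ne_zero.2 (ne_of_mem_rectBoundary hs hw)))).continuousWithinAt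

lemma rectIntegral_sub_zpow_of_ne (hw : w ∈ Ioo u v ×ℂ Ioo b t) {n : ℤ} (hn : n ≠ -1) :
    rectIntegral (fun s => (s - w) ^ n) u v b t = 0 := by
  obtain ⟨⟨hu, hv⟩, hb, ht⟩ := mem_reProdIm.1 hw
  have hn' : (n + 1 : ℂ) ≠ 0 := by exact_mod_cast fun h => hn (by omega)
  refine rectIntegral_eq_zero_of_hasDerivAt (F := fun s => (s - w) ^ (n + 1) / (n + 1))
    (hu.trans hv).le (hb.trans ht).le (continuousOn_sub_zpow hw n) fun s hs => ?_
  have h := ((hasDerivAt_zpow (n + 1) (s - w)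
    (.inl (sub_ne_zero.2 (ne_of_mem_rectBoundary hs hw)))).comp s
    ((hasDerivAt_id s).sub_const w)).div_const (n + 1 : ℂ)
  push_cast at h
  rwa [mul_one, mul_div_cancel_left₀ _ hn', add_sub_cancel_right] at h

-- Three sides avoid the cut of `log (s - w)` and the left side that of `log (w - s)`; on the two
-- left corners the branches differ by `±πi`.
lemma rectIntegral_sub_inv (hw : w ∈ Ioo u v ×ℂ Ioo b t) :
    rectIntegral (fun s => (s - w)⁻¹) u v b t = 2 * π * I := by
  obtain ⟨⟨hu, hv⟩, hb, ht⟩ := mem_reProdIm.1 hw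
  have huv := (hu.trans hv).le
  have hbt := (hb.trans ht).le
  have hc : ContinuousOn (fun s => (s - w)⁻¹) (rectBoundary u v b t) := by
    simpa only [zpow_neg_one] using continuousOn_sub_zpow hw (-1)
  have hlog : ∀ s : ℂ, s - w ∈ slitPlane → HasDerivAt (fun s => log (s - w)) (s - w)⁻¹ s :=
    fun s hs => by simpa using ((hasDerivAt_id s).sub_const w).clog hs
  have hlog' : ∀ s : ℂ, w - s ∈ slitPlane → HasDerivAt (fun s => log (w - s)) (s - w)⁻¹ s :=
    fun s hs => by
      have h := ((hasDerivAt_id s).const_sub w).clog hs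
      rwa [id, ← neg_sub s w, neg_div_neg_eq, one_div] at h
  have hbot := horizontalIntegral_eq_sub_of_hasDerivAt
    (fun x _ => hlog _ (mem_slitPlane_iff.2 (.inr (by simpa [sub_eq_zero] using hb.ne))))
    (horizontal_intervalIntegrable huv hbt hc (.inl rfl))
  have htop := horizontalIntegral_eq_sub_of_hasDerivAt
    (fun x _ => hlog _ (mem_slitPlane_iff.2 (.inr (by simpa [sub_eq_zero] using ht.ne'))))
    (horizontal_intervalIntegrable huv hbt hc (.inr rfl))
  have hright := I_mul_verticalIntegral_eq_sub_of_hasDerivAt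
    (fun y _ => hlog _ (mem_slitPlane_iff.2 (.inl (by simpa using hv))))
    (vertical_intervalIntegrable huv hbt hc (.inr rfl))
  have hleft := I_mul_verticalIntegral_eq_sub_of_hasDerivAt
    (fun y _ => hlog' _ (mem_slitPlane_iff.2 (.inl (by simpa using hu))))
    (vertical_intervalIntegrable huv hbt hc (.inl rfl))
  have hupper : log (w - (u + t * I)) = log (u + t * I - w) - π * I := by
    rw [← neg_sub, log, log, norm_neg, arg_neg_eq_arg_sub_pi_of_im_pos (by simpa using ht)]
    push_cast; ring
  have hlower : log (w - (u + b * I)) = log (u + b * I - w) + π * I := by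
    rw [← neg_sub, log, log, norm_neg, arg_neg_eq_arg_add_pi_of_im_neg (by simpa using hb)]
    push_cast; ring
  rw [rectIntegral, hbot, htop, hright, hleft, hupper, hlower]
  ring

end RectangleIntegral

section Residue

open Polynomial

variable {f : ℂ → ℂ} {u v b t : ℝ} {w r : ℂ}

lemma isLittleO_sub_inv_of_continuousAt (hf : ContinuousAt f w) :
    f =o[𝓝[≠] w] fun s => (s - w)⁻¹ :=
  (hf.norm.isBoundedUnder_le.mono nhdsWithin_le_nhds).isLittleO_sub_self_inv

lemma rectIntegral_eq_zero_of_isLittleO (huv : u ≤ v) (hbt : b ≤ t) {P : Set ℂ} (hP : P.Finite)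
    (hPsub : P ⊆ Ioo u v ×ℂ Ioo b t)
    (hd : ∀ s ∈ Icc u v ×ℂ Icc b t, s ∉ P → DifferentiableAt ℂ f s)
    (ho : ∀ w ∈ P, f =o[𝓝[≠] w] fun s => (s - w)⁻¹) : rectIntegral f u v b t = 0 := by
  classical
  -- `g` is `f` with its removable singularities removed.
  set g : ℂ → ℂ := P.piecewise (fun w => limUnder (𝓝[≠] w) f) f with hg
  have hisol : ∀ s, ∀ᶠ z in 𝓝[≠] s, z ∉ P := fun s => by
    have := (hP.subset sdiff_subset).isClosed.isOpen_compl.mem_nhds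
      (show s ∈ (P \ {s})ᶜ by simp)
    filter_upwards [nhdsWithin_le_nhds this, self_mem_nhdsWithin] with z hz hne hzP
    exact hz ⟨hzP, hne⟩
  have hgf : ∀ s, g =ᶠ[𝓝[≠] s] f := fun s =>
    (hisol s).mono fun z hz => piecewise_eq_of_notMem _ _ _ hz
  have hgd : ∀ s ∈ Icc u v ×ℂ Icc b t, s ∉ P → DifferentiableAt ℂ g s := fun s hs hsP =>
    (hd s hs hsP).congr_of_eventuallyEq <|
      Filter.Eventually.mono (hP.isClosed.isOpen_compl.mem_nhds hsP) fun z hz =>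
        piecewise_eq_of_notMem _ _ _ hz
  have hgc : ContinuousOn g (Icc u v ×ℂ Icc b t) := fun s hs => by
    refine ContinuousAt.continuousWithinAt ?_
    by_cases hsP : s ∈ P
    · have hfd : ∀ᶠ z in 𝓝[≠] s, DifferentiableAt ℂ f z := by
        have hopen := (isOpen_Ioo.reProdIm isOpen_Ioo).mem_nhds (hPsub hsP)
        filter_upwards [hisol s, nhdsWithin_le_nhds hopen] with z hzP hz
        exact hd z (reProdIm_subset_iff.2 (by gcongr <;> exact Ioo_subset_Icc_self) hz) hzP
      have hlim := tendsto_limUnder_of_differentiable_on_punctured_nhds_of_isLittleO hfd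
        ((ho s hsP).sub (isLittleO_sub_inv_of_continuousAt continuousAt_const))
      rw [continuousAt_iff_punctured_nhds, hg, piecewise_eq_of_mem _ _ _ hsP]
      exact hlim.congr' (hgf s).symm
    · exact (hgd s hs hsP).continuousAt
  have hcongr : EqOn f g (rectBoundary u v b t) := fun s hs =>
    (piecewise_eq_of_notMem _ _ _ fun hsP => hs.2 (hPsub hsP)).symm
  have hcauchy := integral_boundary_rect_eq_zero_of_differentiable_on_off_countable g
    (u + b * I) (v + t * I) P hP.countable
    (by simpa [uIcc_of_le huv, uIcc_of_le hbt] using hgc)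
    (by
      simp only [add_re, ofReal_re, mul_re, I_re, mul_zero, ofReal_im, I_im, sub_zero, add_zero,
        add_im, mul_im, mul_one, zero_add, min_eq_left huv, max_eq_right huv, min_eq_left hbt,
        max_eq_right hbt]
      exact fun s hs => hgd s
        ⟨Ioo_subset_Icc_self hs.1.1, Ioo_subset_Icc_self hs.1.2⟩ hs.2)
  rw [rectIntegral_congr huv hbt hcongr]
  simpa [rectIntegral, horizontalIntegral, verticalIntegral] using hcauchy

/-- `f` has at `w` an isolated singularity which is at most a pole, with residue `r`: up to
`o(1 / (s - w))`, which is enough for the residue theorem, `f` is a polynomial in `1 / (s - w)`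
whose coefficient at `1 / (s - w)` is `r`. -/
def HasResidueAt (f : ℂ → ℂ) (w r : ℂ) : Prop :=
  ∃ p : ℂ[X], p.coeff 1 = r ∧
    (fun s => f s - p.eval (s - w)⁻¹) =o[𝓝[≠] w] fun s => (s - w)⁻¹

lemma hasResidueAt_of_tendsto (h : Tendsto (fun s => (s - w) * f s) (𝓝[≠] w) (𝓝 r)) :
    HasResidueAt f w r := by
  refine ⟨C r * X, by simp, ?_⟩
  refine (isLittleO_iff_tendsto' ?_).2 ?_
  · filter_upwards [self_mem_nhdsWithin] with s hs h0
    exact absurd h0 (inv_ne_zero (sub_ne_zero.2 hs))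
  · refine ((h.sub_const r).congr' ?_).trans_eq (by rw [sub_self])
    filter_upwards [self_mem_nhdsWithin] with s hs
    have : s - w ≠ 0 := sub_ne_zero.2 hs
    simp only [eval_mul, eval_C, eval_X]
    field_simp

lemma continuousOn_eval_sub_inv (p : ℂ[X]) (hw : w ∈ Ioo u v ×ℂ Ioo b t) :
    ContinuousOn (fun s => p.eval (s - w)⁻¹) (rectBoundary u v b t) := by
  refine p.continuous.comp_continuousOn ?_
  simpa only [zpow_neg_one] using continuousOn_sub_zpow hw (-1)

lemma rectIntegral_eval_sub_inv (p : ℂ[X]) (hw : w ∈ Ioo u v ×ℂ Ioo b t) :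
    rectIntegral (fun s => p.eval (s - w)⁻¹) u v b t = 2 * π * I * p.coeff 1 := by
  obtain ⟨⟨hu, hv⟩, hb, ht⟩ := mem_reProdIm.1 hw
  have hpow : ∀ (n : ℕ) (s : ℂ), (s - w)⁻¹ ^ n = (s - w) ^ (-n : ℤ) := fun n s => by
    rw [zpow_neg, zpow_natCast, inv_pow]
  have hterm : ∀ n : ℕ, rectIntegral (fun s => p.coeff n * (s - w) ^ (-n : ℤ)) u v b t =
      if n = 1 then 2 * π * I * p.coeff 1 else 0 := fun n => by
    rw [rectIntegral_const_mul]
    split_ifs with hn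
    · subst hn
      simp only [Nat.cast_one, zpow_neg_one, rectIntegral_sub_inv hw]
      ring
    · rw [rectIntegral_sub_zpow_of_ne hw (by omega), mul_zero]
  simp only [eval_eq_sum_range, hpow]
  rw [rectIntegral_sum _ (f := fun n s => p.coeff n * (s - w) ^ (-n : ℤ)) (hu.trans hv).le
    (hb.trans ht).le fun n _ => continuousOn_const.mul (continuousOn_sub_zpow hw _)]
  simp only [hterm, Finset.sum_ite_eq', Finset.mem_range]
  split_ifs with h
  · rfl
  · rw [coeff_eq_zero_of_natDegree_lt (by omega), mul_zero]

theorem rectIntegral_eq_sum_residues {κ : Type*} (J : Finset κ) {w r : κ → ℂ} (huv : u ≤ v)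
    (hbt : b ≤ t) (hw : ∀ j ∈ J, w j ∈ Ioo u v ×ℂ Ioo b t) (hinj : InjOn w J)
    (hd : ∀ s ∈ Icc u v ×ℂ Icc b t, (∀ j ∈ J, s ≠ w j) → DifferentiableAt ℂ f s)
    (hres : ∀ j ∈ J, HasResidueAt f (w j) (r j)) :
    rectIntegral f u v b t = 2 * π * I * ∑ j ∈ J, r j := by
  classical
  choose! p hpr hpo using hres
  set q : κ → ℂ → ℂ := fun j s => (p j).eval (s - w j)⁻¹
  have hqd : ∀ j s, s ≠ w j → DifferentiableAt ℂ (q j) s := fun j s hs =>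
    (p j).differentiableAt.comp s
      ((differentiableAt_id.sub_const _).inv (sub_ne_zero.2 hs))
  have hregular : rectIntegral (fun s => f s + -1 * ∑ j ∈ J, q j s) u v b t = 0 := by
    refine rectIntegral_eq_zero_of_isLittleO huv hbt (J.finite_toSet.image w)
      (by rintro _ ⟨j, hj, rfl⟩; exact hw j hj) (fun s hs hsP => ?_) ?_
    · have hne : ∀ j ∈ J, s ≠ w j := fun j hj h => hsP ⟨j, hj, h.symm⟩
      exact (hd s hs hne).add
        ((DifferentiableAt.fun_sum fun j hj => hqd j s (hne j hj)).const_mul _)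
    · rintro _ ⟨i, hi, rfl⟩
      have hother : ContinuousAt (fun s => ∑ j ∈ J.erase i, q j s) (w i) :=
        (DifferentiableAt.fun_sum fun j hj => hqd j _ fun h =>
          Finset.ne_of_mem_erase hj (hinj (Finset.mem_of_mem_erase hj) hi h.symm)).continuousAt
      refine ((hpo i hi).sub (isLittleO_sub_inv_of_continuousAt hother)).congr_left fun s => ?_
      rw [← Finset.add_sum_erase J _ hi]
      ring
  have hqc : ∀ j ∈ J, ContinuousOn (q j) (rectBoundary u v b t) := fun j hj =>
    continuousOn_eval_sub_inv (p j) (hw j hj)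
  have hfc : ContinuousOn f (rectBoundary u v b t) := fun s hs =>
    (hd s hs.1 fun j hj => ne_of_mem_rectBoundary hs (hw j hj)).continuousAt.continuousWithinAt
  rw [rectIntegral_add huv hbt hfc
      (g := fun s => -1 * ∑ j ∈ J, q j s) (continuousOn_const.mul (continuousOn_finsetSum _ hqc)),
    rectIntegral_const_mul, rectIntegral_sum J huv hbt hqc] at hregular
  rw [← sub_eq_zero, ← hregular, Finset.mul_sum, sub_eq_add_neg, neg_one_mul]
  congr 2
  exact Finset.sum_congr rfl fun j hj => by rw [rectIntegral_eval_sub_inv _ (hw j hj), hpr j hj]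

end Residue

section AsymptoticExpansion

open PowerSeries

/-- `f` has the formal power series `φ` as its asymptotic expansion at `0`: every truncation of
`φ` approximates `f` near `0` up to the first omitted power. -/
def HasAsymptoticExpansion (f : ℂ → ℂ) (φ : ℂ⟦X⟧) : Prop :=
  ∀ n, (fun s => f s - (trunc n φ).eval s) =O[𝓝[≠] 0] (· ^ n)

variable {f g : ℂ → ℂ} {φ ψ : ℂ⟦X⟧}

lemma isBigO_pow_of_X_pow_dvd {p : Polynomial ℂ} {n : ℕ} (h : Polynomial.X ^ n ∣ p) :
    (p.eval ·) =O[𝓝[≠] 0] (· ^ n) := by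
  obtain ⟨q, rfl⟩ := h
  have hq : (q.eval ·) =O[𝓝[≠] 0] fun _ : ℂ => (1 : ℂ) :=
    (q.continuous.continuousAt.isBigO_one ℂ).mono nhdsWithin_le_nhds
  simpa using (isBigO_refl (fun s : ℂ => s ^ n) (𝓝[≠] 0)).mul hq

lemma hasAsymptoticExpansion_polynomial (p : Polynomial ℂ) :
    HasAsymptoticExpansion (p.eval ·) (p : ℂ⟦X⟧) := fun n => by
  have h : Polynomial.X ^ n ∣ p - trunc n (p : ℂ⟦X⟧) :=
    Polynomial.X_pow_dvd_iff.2 fun d hd => by simp [coeff_trunc, hd]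
  simpa using isBigO_pow_of_X_pow_dvd h

namespace HasAsymptoticExpansion

lemma isBigO_one (hf : HasAsymptoticExpansion f φ) : f =O[𝓝[≠] 0] fun _ => (1 : ℂ) := by
  simpa using hf 0

lemma congr' (hf : HasAsymptoticExpansion f φ) (h : f =ᶠ[𝓝[≠] 0] g) :
    HasAsymptoticExpansion g φ := fun n =>
  (hf n).congr' (h.mono fun s hs => by simp only [hs]) .rfl

lemma sub (hf : HasAsymptoticExpansion f φ) (hg : HasAsymptoticExpansion g ψ) :
    HasAsymptoticExpansion (fun s => f s - g s) (φ - ψ) := fun n =>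
  ((hf n).sub (hg n)).congr_left fun s => by rw [trunc_sub, Polynomial.eval_sub]; ring

lemma mul (hf : HasAsymptoticExpansion f φ) (hg : HasAsymptoticExpansion g ψ) :
    HasAsymptoticExpansion (fun s => f s * g s) (φ * ψ) := fun n => by
  have hfg := (hf n).mul hg.isBigO_one
  have hPg := (hasAsymptoticExpansion_polynomial (trunc n φ)).isBigO_one.mul (hg n)
  have hPQ := hasAsymptoticExpansion_polynomial (trunc n φ * trunc n ψ) n
  rw [Polynomial.coe_mul, trunc_trunc_mul_trunc] at hPQ
  simp only [mul_one, one_mul] at hfg hPg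
  refine ((hfg.add hPg).add hPQ).congr_left fun s => ?_
  simp only [Polynomial.eval_mul]
  ring

lemma prod {ι : Type*} (J : Finset ι) {f : ι → ℂ → ℂ} {φ : ι → ℂ⟦X⟧}
    (h : ∀ i ∈ J, HasAsymptoticExpansion (f i) (φ i)) :
    HasAsymptoticExpansion (fun s => ∏ i ∈ J, f i s) (∏ i ∈ J, φ i) := by
  classical
  induction J using Finset.induction_on with
  | empty => simpa using hasAsymptoticExpansion_polynomial 1
  | insert a J ha ih =>
    rw [Finset.forall_mem_insert] at h
    simpa only [Finset.prod_insert ha] using h.1.mul (ih h.2)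

lemma id_div (hf : HasAsymptoticExpansion f φ) (h₀ : constantCoeff φ = 0) (h : ψ * φ = X) :
    HasAsymptoticExpansion (fun s => s / f s) ψ := fun n => by
  have h₁ : coeff 1 φ ≠ 0 := fun h₁ => by
    have := congr_arg (coeff 1) h
    simp [coeff_mul, Finset.Nat.antidiagonal_succ, h₁, h₀] at this
  have hlinear : (fun s => f s - coeff 1 φ * s) =o[𝓝[≠] 0] fun s => coeff 1 φ * s := by
    refine IsBigO.trans_isLittleO (g := (· ^ 2)) ?_ ?_
    · simpa [trunc_succ, h₀] using hf 2
    · simpa using ((isLittleO_pow_pow one_lt_two).mono nhdsWithin_le_nhds).const_mul_right h₁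
  have hsf : (fun s : ℂ => s) =O[𝓝[≠] 0] f :=
    ((isBigO_refl _ _).const_mul_right h₁).trans
      (IsEquivalent.isBigO_symm hlinear)
  have hne : ∀ᶠ s in 𝓝[≠] (0 : ℂ), s ≠ 0 := self_mem_nhdsWithin
  have hinv : (fun s => (f s)⁻¹) =O[𝓝[≠] 0] fun s => s⁻¹ :=
    hsf.inv_rev (hne.mono fun s hs h => absurd h hs)
  have hfQ : (fun s => s - (trunc (n + 1) ψ).eval s * f s) =O[𝓝[≠] 0] (· ^ (n + 1)) := by
    have hQf := ((hasAsymptoticExpansion_polynomial (trunc (n + 1) ψ)).mul hf) (n + 1)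
    have hX := hasAsymptoticExpansion_polynomial Polynomial.X (n + 1)
    rw [trunc_trunc_mul, h] at hQf
    simpa using hX.sub hQf
  have hsucc : (fun s => s / f s - (trunc (n + 1) ψ).eval s) =O[𝓝[≠] 0] (· ^ n) := by
    refine (hfQ.mul hinv).congr' ?_ ?_
    · filter_upwards [hne, hsf.eq_zero_imp] with s hs hfs
      have : f s ≠ 0 := fun h => hs (hfs h)
      field_simp
    · filter_upwards [hne] with s hs
      rw [pow_succ, mul_inv_cancel_right₀ hs]
  have hQ := hasAsymptoticExpansion_polynomial (trunc (n + 1) ψ) n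
  rw [trunc_trunc_of_le _ n.le_succ] at hQ
  simpa using hsucc.add hQ

end HasAsymptoticExpansion

lemma hasAsymptoticExpansion_exp_mul (a : ℂ) :
    HasAsymptoticExpansion (fun s => Complex.exp (a * s)) (rescale a (PowerSeries.exp ℂ)) :=
  fun n => by
  have ha : Tendsto (fun s => a * s) (𝓝[≠] 0) (𝓝 0) := by
    simpa using (continuous_const_mul a).tendsto' 0 0 (by simp) |>.mono_left nhdsWithin_le_nhds
  have hpow : (fun s : ℂ => (a * s) ^ n) =O[𝓝[≠] 0] (· ^ n) := by
    simpa only [mul_pow] using isBigO_const_mul_self (a ^ n) (fun s : ℂ => s ^ n) _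
  refine (((Complex.exp_sub_sum_range_isBigO_pow n).comp_tendsto ha).trans hpow).congr_left
    fun s => ?_
  simp only [Function.comp_apply, Polynomial.eval, eval₂_trunc_eq_sum_range, coeff_rescale,
    coeff_exp, map_div₀, map_one, map_natCast, RingHom.id_apply]
  congr 1
  exact Finset.sum_congr rfl fun k _ => by ring

lemma hasAsymptoticExpansion_id_div_one_sub_exp {a : ℂ} (ha : a ≠ 0) :
    HasAsymptoticExpansion (fun s => s / (1 - Complex.exp (-(a * s))))
      (C a⁻¹ * rescale a (bernoulli'PowerSeries ℂ)) := by
  have h1 : HasAsymptoticExpansion (fun s => 1 - Complex.exp (-(a * s)))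
      (1 - rescale (-a) (PowerSeries.exp ℂ)) := by
    simpa using (hasAsymptoticExpansion_polynomial 1).sub (hasAsymptoticExpansion_exp_mul (-a))
  refine h1.id_div ?_ ?_
  · rw [← coeff_zero_eq_constantCoeff_apply, map_sub, coeff_rescale]
    simp
  have hexp : rescale a (PowerSeries.exp ℂ) * rescale (-a) (PowerSeries.exp ℂ) = 1 := by
    rw [exp_mul_exp_eq_exp_add, add_neg_cancel]
    simp
  have hber := congr_arg (rescale a) (bernoulli'PowerSeries_mul_exp_sub_one ℂ)
  simp only [map_mul, map_sub, map_one, rescale_X] at hber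
  have hC : C a⁻¹ * C a = (1 : ℂ⟦X⟧) := by rw [← map_mul, inv_mul_cancel₀ ha, map_one]
  linear_combination (C a⁻¹ * rescale (-a) (PowerSeries.exp ℂ)) * hber +
    X * hC + (C a⁻¹ * C a * X - C a⁻¹ * rescale a (bernoulli'PowerSeries ℂ)) * hexp

lemma hasResidueAt_zero_of_hasAsymptoticExpansion {d : ℕ}
    (h : HasAsymptoticExpansion (fun s => s ^ (d + 1) * f s) φ) :
    HasResidueAt f 0 (coeff d φ) := by
  refine ⟨(trunc (d + 1) φ).reflect (d + 1), ?_, ?_⟩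
  · simp [Polynomial.coeff_reflect, Polynomial.revAt_le, coeff_trunc]
  · have hne : ∀ᶠ s in 𝓝[≠] (0 : ℂ), s ≠ 0 := self_mem_nhdsWithin
    have h1 : (fun s => f s - ((trunc (d + 1) φ).reflect (d + 1)).eval (s - 0)⁻¹)
        =O[𝓝[≠] 0] fun _ => (1 : ℂ) := by
      refine (((isBigO_refl (fun s : ℂ => (s ^ (d + 1))⁻¹) _).mul (h (d + 1))).congr' ?_ ?_)
      · filter_upwards [hne] with s hs
        let _ := invertibleOfNonzero hs
        have := Polynomial.eval₂_reflect_mul_pow (RingHom.id ℂ) s (d + 1) (trunc (d + 1) φ)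
          (natDegree_trunc_lt φ d).le
        rw [invOf_eq_inv] at this
        rw [sub_zero, Polynomial.eval, Polynomial.eval, ← this]
        field_simp
      · filter_upwards [hne] with s hs
        field_simp
    refine h1.trans_isLittleO (isLittleO_sub_inv_of_continuousAt continuousAt_const)

end AsymptoticExpansion

section PerronKernel

variable {ι : Type*} [Fintype ι]

/-- The integrand `e^{Ls} / s · ∏ᵢ (1 - e^{-αᵢ s})⁻¹` of Perron's formula for the number of
`n : ι → ℕ` with `∑ᵢ nᵢ αᵢ ≤ L`: expanding the geometric series turns it into the sum of
`e^{(L - ∑ᵢ nᵢ αᵢ) s} / s` over all `n`. -/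
def perronKernel (α : ι → ℝ) (L : ℝ) (s : ℂ) : ℂ :=
  exp (L * s) / s * ∏ i, (1 - exp (-(α i * s)))⁻¹

/-- The generating series `e^{Lt} · ∏ᵢ t / (1 - e^{-αᵢ t})` of Todd polynomials; the Bernoulli
numbers are those with `B₁ = 1/2`. -/
def toddSeries (α : ι → ℝ) (L : ℝ) : PowerSeries ℝ :=
  PowerSeries.rescale L (PowerSeries.exp ℝ) *
    ∏ i, PowerSeries.C (α i)⁻¹ * PowerSeries.rescale (α i) (bernoulli'PowerSeries ℝ)

/-- The residue of the Perron kernel at `0`, which is the polynomial main term of the lattice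
point count. -/
def toddPolynomial (α : ι → ℝ) (L : ℝ) : ℝ :=
  PowerSeries.coeff (Fintype.card ι) (toddSeries α L)

/-- The pole `2πik / a` of `(1 - e^{-as})⁻¹`. -/
def perronPole (a : ℝ) (k : ℤ) : ℂ := (2 * π * k / a : ℝ) * I

/-- The residue of the Perron kernel at its pole `2πik / αᵢ`, for `k ≠ 0`. -/
def perronResidue [DecidableEq ι] (α : ι → ℝ) (L : ℝ) (i : ι) (k : ℤ) : ℂ :=
  exp (L * perronPole (α i) k) / (2 * π * k * I) *
    ∏ j ∈ Finset.univ.erase i, (1 - exp (-(α j * perronPole (α i) k)))⁻¹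

variable {α : ι → ℝ} {L a : ℝ} {s : ℂ}

lemma hasResidueAt_perronKernel_zero (hα : ∀ i, α i ≠ 0) (L : ℝ) :
    HasResidueAt (perronKernel α L) 0 (toddPolynomial α L) := by
  have hmap : PowerSeries.map ofRealHom (toddSeries α L) =
      PowerSeries.rescale (L : ℂ) (PowerSeries.exp ℂ) * ∏ i, PowerSeries.C (α i : ℂ)⁻¹ *
        PowerSeries.rescale (α i : ℂ) (bernoulli'PowerSeries ℂ) := by
    have hrescale : ∀ (x : ℝ) (φ : PowerSeries ℝ), PowerSeries.map ofRealHom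
        (PowerSeries.rescale x φ) = PowerSeries.rescale (x : ℂ) (PowerSeries.map ofRealHom φ) :=
      fun x φ => by ext n; simp
    have hbernoulli : PowerSeries.map ofRealHom (bernoulli'PowerSeries ℝ) =
        bernoulli'PowerSeries ℂ := by ext n; simp [bernoulli'PowerSeries]
    simp [toddSeries, map_prod, hrescale, hbernoulli]
  have hexp := (hasAsymptoticExpansion_exp_mul L).mul <| .prod Finset.univ fun i _ =>
    hasAsymptoticExpansion_id_div_one_sub_exp (ofReal_ne_zero.2 (hα i))
  rw [← hmap] at hexp
  have hcoeff : (toddPolynomial α L : ℂ) =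
      PowerSeries.coeff (Fintype.card ι) (PowerSeries.map ofRealHom (toddSeries α L)) := by
    simp [toddPolynomial]
  rw [hcoeff]
  refine hasResidueAt_zero_of_hasAsymptoticExpansion (hexp.congr' ?_)
  filter_upwards [self_mem_nhdsWithin] with s hs
  have : s ≠ 0 := hs
  simp only [perronKernel, div_eq_mul_inv, Finset.prod_mul_distrib, Finset.prod_const,
    Finset.card_univ, pow_succ]
  field_simp

lemma perronPole_ne_zero (ha : a ≠ 0) {k : ℤ} (hk : k ≠ 0) : perronPole a k ≠ 0 := by
  simp [perronPole, ha, hk, Real.pi_ne_zero]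

lemma mul_perronPole (ha : a ≠ 0) (k : ℤ) : a * perronPole a k = 2 * π * k * I := by
  have : (a : ℂ) ≠ 0 := ofReal_ne_zero.2 ha
  rw [perronPole]
  push_cast
  field_simp

lemma exp_neg_mul_eq_one_iff (ha : a ≠ 0) : exp (-(a * s)) = 1 ↔ ∃ k : ℤ, s = perronPole a k := by
  have ha' : (a : ℂ) ≠ 0 := ofReal_ne_zero.2 ha
  rw [← inv_inj, ← exp_neg, neg_neg, inv_one, exp_eq_one_iff]
  refine exists_congr fun k => ?_
  rw [← mul_right_inj' ha' (b := s), mul_perronPole ha]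
  ring_nf

omit [Fintype ι] in
lemma eq_and_eq_of_perronPole_eq (hα : ∀ i, 0 < α i)
    (hirr : Pairwise fun i j => Irrational (α i / α j)) {i j : ι} {k l : ℤ} (hk : k ≠ 0)
    (h : perronPole (α i) k = perronPole (α j) l) : i = j ∧ k = l := by
  have hkl : (k : ℝ) / α i = l / α j := by
    have := mul_right_cancel₀ I_ne_zero h
    rw [ofReal_inj, mul_div_assoc, mul_div_assoc] at this
    exact mul_left_cancel₀ (by positivity) this
  have hi := (hα i).ne'
  have hj := (hα j).ne'
  obtain rfl | hij := eq_or_ne i j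
  · exact ⟨rfl, by exact_mod_cast (div_left_inj' hi).1 hkl⟩
  · have hk' : (k : ℝ) ≠ 0 := Int.cast_ne_zero.2 hk
    refine absurd ⟨l / k, ?_⟩ (hirr hij.symm)
    push_cast
    field_simp at hkl ⊢
    linarith

lemma differentiableAt_perronKernel (L : ℝ) (hs : s ≠ 0) (h : ∀ i, exp (-(α i * s)) ≠ 1) :
    DifferentiableAt ℂ (perronKernel α L) s :=
  .mul (.div (by fun_prop) (by fun_prop) hs) <| DifferentiableAt.fun_finsetProd fun i _ =>
    DifferentiableAt.fun_inv (by fun_prop) (sub_ne_zero.2 (h i).symm)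

lemma tendsto_sub_mul_inv_one_sub_exp (ha : a ≠ 0) (k : ℤ) :
    Tendsto (fun s => (s - perronPole a k) * (1 - exp (-(a * s)))⁻¹) (𝓝[≠] (perronPole a k))
      (𝓝 (a : ℂ)⁻¹) := by
  have hexp : exp (-(a * perronPole a k)) = 1 := (exp_neg_mul_eq_one_iff ha).2 ⟨k, rfl⟩
  have hderiv : HasDerivAt (fun s : ℂ => 1 - exp (-(a * s))) a (perronPole a k) := by
    have := (((hasDerivAt_id' (perronPole a k)).const_mul (a : ℂ)).fun_neg.cexp).const_sub 1
    simpa [hexp] using this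
  refine ((hasDerivAt_iff_tendsto_slope.1 hderiv).inv₀ (ofReal_ne_zero.2 ha)).congr fun s => ?_
  rw [slope_def_field, hexp, inv_div, sub_self, sub_zero, div_eq_mul_inv]

lemma hasResidueAt_perronKernel [DecidableEq ι] (hα : ∀ i, 0 < α i)
    (hirr : Pairwise fun i j => Irrational (α i / α j)) (L : ℝ) (i : ι) {k : ℤ} (hk : k ≠ 0) :
    HasResidueAt (perronKernel α L) (perronPole (α i) k) (perronResidue α L i k) := by
  have hi := (hα i).ne'
  have hw := perronPole_ne_zero hi hk
  have hregular : ContinuousAt (fun s => exp (L * s) / s *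
      ∏ j ∈ Finset.univ.erase i, (1 - exp (-(α j * s)))⁻¹) (perronPole (α i) k) := by
    refine .mul (.div (by fun_prop) (by fun_prop) hw) <| tendsto_finsetProd _ fun j hj =>
      ContinuousAt.inv₀ (f := fun s => 1 - exp (-(α j * s))) (by fun_prop) fun h => ?_
    obtain ⟨l, hl⟩ := (exp_neg_mul_eq_one_iff (hα j).ne').1 (sub_eq_zero.1 h).symm
    exact Finset.ne_of_mem_erase hj (eq_and_eq_of_perronPole_eq hα hirr hk hl).1.symm
  refine hasResidueAt_of_tendsto ?_
  have h := (tendsto_sub_mul_inv_one_sub_exp hi k).mul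
    (hregular.tendsto.mono_left nhdsWithin_le_nhds)
  refine (h.congr fun s => ?_).trans_eq ?_
  · rw [perronKernel, ← Finset.mul_prod_erase Finset.univ _ (Finset.mem_univ i)]
    ring
  · have : (α i : ℂ) ≠ 0 := ofReal_ne_zero.2 hi
    rw [perronResidue, ← mul_perronPole hi]
    field_simp

end PerronKernel

section LineIntegral

/-- The integral of `f`, in the variable `Im s`, over the part `|Im s| ≤ T` of the line
`Re s = 1`. -/
def lineIntegral (f : ℂ → ℂ) (T : ℝ) : ℂ := verticalIntegral f (-T) T 1

variable {f g : ℂ → ℂ} {u v b t A B M M' T : ℝ} {V : ℂ}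

lemma norm_horizontalIntegral_le (hA : A ≠ 0) (huv : u ≤ v)
    (hf : ∀ x ∈ Icc u v, ‖f (x + t * I)‖ ≤ M * Real.exp (A * x)) :
    ‖horizontalIntegral f u v t‖ ≤ M * ((Real.exp (A * v) - Real.exp (A * u)) / A) := by
  have hexp : ∫ x in u..v, Real.exp (A * x) = (Real.exp (A * v) - Real.exp (A * u)) / A := by
    rw [intervalIntegral.integral_comp_mul_left _ hA, integral_exp, smul_eq_mul, inv_mul_eq_div]
  rw [← hexp, ← intervalIntegral.integral_const_mul]
  exact intervalIntegral.norm_integral_le_of_norm_le huv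
    (Eventually.of_forall fun x hx => hf x (Ioc_subset_Icc_self hx))
    (Continuous.intervalIntegrable (by fun_prop) _ _)

lemma tendsto_verticalIntegral_zero {l : Filter ℝ} {h : ℝ → ℝ} (hh : Tendsto h l (𝓝 0))
    (hf : ∀ᶠ x : ℝ in l, ∀ y : ℝ, ‖f (x + y * I)‖ ≤ h x) :
    Tendsto (verticalIntegral f b t) l (𝓝 0) := by
  refine squeeze_zero_norm' ?_ (by simpa using hh.mul_const |t - b|)
  filter_upwards [hf] with x hx
  exact intervalIntegral.norm_integral_le_of_norm_le_const fun y _ => hx y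

lemma norm_sub_lineIntegral_le_two_mul {l : Filter ℝ} [NeBot l] (hT : 0 ≤ T)
    (hhor : ∀ᶠ x in l, ∀ t, |t| = T → ‖horizontalIntegral f x 1 t‖ ≤ M)
    (hvert : Tendsto (verticalIntegral f (-T) T) l (𝓝 0))
    (hrect : ∀ᶠ x in l, rectIntegral f x 1 (-T) T = I * V) :
    ‖V - lineIntegral f T‖ ≤ 2 * M := by
  have hlim := hvert.norm.const_add (2 * M)
  rw [norm_zero, add_zero] at hlim
  refine ge_of_tendsto hlim ?_
  filter_upwards [hhor, hrect] with x hx hV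
  have hline : I * (V - lineIntegral f T) = horizontalIntegral f x 1 (-T) -
      horizontalIntegral f x 1 T - I * verticalIntegral f (-T) T x := by
    rw [mul_sub, ← hV, rectIntegral, lineIntegral]
    ring
  calc ‖V - lineIntegral f T‖ = ‖I * (V - lineIntegral f T)‖ := by simp
    _ ≤ M + M + ‖verticalIntegral f (-T) T x‖ := by
        rw [hline]
        refine (norm_sub_le _ _).trans (add_le_add ((norm_sub_le _ _).trans (add_le_add ?_ ?_)) ?_)
        · exact hx _ (by rw [abs_neg, abs_of_nonneg hT])
        · exact hx _ (abs_of_nonneg hT)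
        · simp
    _ = _ := by ring

lemma norm_sub_lineIntegral_le (hA : 0 < A) (hT : 0 ≤ T)
    (hhor : ∀ x t : ℝ, |t| = T → ‖f (x + t * I)‖ ≤ M * Real.exp (A * x))
    (hleft : ∀ x y : ℝ, x ≤ -1 → ‖f (x + y * I)‖ ≤ M' * Real.exp (A * x))
    (hrect : ∀ x ≤ -1, rectIntegral f x 1 (-T) T = I * V) :
    ‖V - lineIntegral f T‖ ≤ 2 * (M * (Real.exp A / A)) := by
  have hM : 0 ≤ M := by simpa using (norm_nonneg _).trans (hhor 0 T (abs_of_nonneg hT))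
  refine norm_sub_lineIntegral_le_two_mul (l := atBot) hT ?_ ?_ ?_
  · filter_upwards [eventually_le_atBot (-1)] with x hx t ht
    refine (norm_horizontalIntegral_le hA.ne' (by linarith) fun x _ => hhor x t ht).trans ?_
    rw [mul_one]
    gcongr
    exact sub_le_self _ (Real.exp_nonneg _)
  · refine tendsto_verticalIntegral_zero (h := fun x => M' * Real.exp (A * x)) ?_ ?_
    · simpa using (Real.tendsto_exp_atBot.comp (tendsto_id.const_mul_atBot hA)).const_mul M'
    · filter_upwards [eventually_le_atBot (-1)] with x hx y using hleft x y hx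
  · filter_upwards [eventually_le_atBot (-1)] with x hx using hrect x hx

lemma norm_lineIntegral_le (hT : 0 < T) (hB : 0 < B)
    (hd : ∀ s : ℂ, 1 ≤ s.re → DifferentiableAt ℂ f s)
    (hf : ∀ s : ℂ, 1 ≤ s.re → ‖f s‖ ≤ M / ‖s‖ * Real.exp (-B * s.re)) :
    ‖lineIntegral f T‖ ≤ 2 * (M / T * (1 / B)) := by
  have hM : 0 ≤ M := by
    have := (norm_nonneg _).trans (hf 1 (by simp))
    rw [norm_one, div_one] at this
    exact nonneg_of_mul_nonneg_left this (Real.exp_pos _)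
  have hbound : ∀ x y r : ℝ, 1 ≤ x → 0 < r → r ≤ ‖(x + y * I : ℂ)‖ →
      ‖f (x + y * I)‖ ≤ M / r * Real.exp (-B * x) := fun x y r hx hr hrs => by
    refine (hf (x + y * I) (by simpa using hx)).trans ?_
    rw [show (x + y * I : ℂ).re = x by simp]
    gcongr
  rw [← norm_neg, ← zero_sub]
  refine norm_sub_lineIntegral_le_two_mul (l := atTop) hT.le ?_ ?_ ?_
  · filter_upwards [eventually_ge_atTop 1] with x hx t ht
    rw [horizontalIntegral, intervalIntegral.integral_symm, norm_neg]
    refine (norm_horizontalIntegral_le (neg_ne_zero.2 hB.ne') hx fun y hy =>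
      hbound y t T hy.1 hT (by simpa [ht] using abs_im_le_norm (y + t * I))).trans ?_
    rw [div_neg, ← neg_div, neg_sub]
    gcongr
    have : Real.exp (-B * 1) ≤ 1 := Real.exp_le_one_iff.2 (by linarith)
    linarith [Real.exp_nonneg (-B * x)]
  · refine tendsto_verticalIntegral_zero (h := fun x => M * Real.exp (-B * x)) ?_ ?_
    · simpa using (Real.tendsto_exp_atBot.comp
        (tendsto_id.const_mul_atTop_of_neg (neg_lt_zero.2 hB))).const_mul M
    · filter_upwards [eventually_ge_atTop 1] with x hx y
      simpa using hbound x y 1 hx one_pos (hx.trans (by simpa using re_le_norm (x + y * I)))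
  · filter_upwards [eventually_ge_atTop 1] with x hx
    have hzero : rectIntegral f 1 x (-T) T = 0 :=
      rectIntegral_eq_zero_of_isLittleO hx (by linarith) finite_empty (empty_subset _)
        (fun s hs _ => hd s hs.1.1) (fun s hs => absurd hs (notMem_empty s))
    rw [mul_zero, ← neg_eq_zero, ← hzero]
    simp only [rectIntegral, horizontalIntegral, intervalIntegral.integral_symm x 1]
    ring

lemma tendsto_lineIntegral_zero (hB : 0 < B)
    (hd : ∀ s : ℂ, 1 ≤ s.re → DifferentiableAt ℂ f s)
    (hf : ∀ s : ℂ, 1 ≤ s.re → ‖f s‖ ≤ M / ‖s‖ * Real.exp (-B * s.re)) :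
    Tendsto (lineIntegral f) atTop (𝓝 0) := by
  have hlim : Tendsto (fun T : ℝ => 2 * (M / T * (1 / B))) atTop (𝓝 0) := by
    simpa using ((tendsto_id.const_div_atTop M).mul_const (1 / B)).const_mul 2
  refine squeeze_zero_norm' ?_ hlim
  filter_upwards [eventually_gt_atTop 0] with T hT using norm_lineIntegral_le hT hB hd hf

lemma intervalIntegrable_one_add_mul_I (hf : ∀ s : ℂ, s.re = 1 → DifferentiableAt ℂ f s) :
    IntervalIntegrable (fun y : ℝ => f ((1 : ℝ) + y * I)) volume b t :=
  Continuous.intervalIntegrable (continuous_iff_continuousAt.2 fun y =>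
    ContinuousAt.comp (f := fun y : ℝ => ((1 : ℝ) + y * I : ℂ))
      (hf _ (by simp)).continuousAt (by fun_prop)) _ _

lemma lineIntegral_add (hf : ∀ s : ℂ, s.re = 1 → DifferentiableAt ℂ f s)
    (hg : ∀ s : ℂ, s.re = 1 → DifferentiableAt ℂ g s) (T : ℝ) :
    lineIntegral (fun s => f s + g s) T = lineIntegral f T + lineIntegral g T :=
  intervalIntegral.integral_add (intervalIntegrable_one_add_mul_I hf)
    (intervalIntegrable_one_add_mul_I hg)

lemma lineIntegral_sum {κ : Type*} (J : Finset κ) {f : κ → ℂ → ℂ}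
    (hf : ∀ j ∈ J, ∀ s : ℂ, s.re = 1 → DifferentiableAt ℂ (f j) s) (T : ℝ) :
    lineIntegral (fun s => ∑ j ∈ J, f j s) T = ∑ j ∈ J, lineIntegral (f j) T :=
  intervalIntegral.integral_finsetSum fun j hj => intervalIntegrable_one_add_mul_I (hf j hj)

lemma lineIntegral_congr (h : ∀ s : ℂ, s.re = 1 → f s = g s) (T : ℝ) :
    lineIntegral f T = lineIntegral g T :=
  intervalIntegral.integral_congr fun y _ => h _ (by simp)

end LineIntegral

section PerronKernelResidues

variable {ι : Type*} [Fintype ι] {α : ι → ℝ} {L a x t R δ : ℝ} {s : ℂ} {k : ℤ}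

lemma two_mul_le_abs_sin_pi_mul {y : ℝ} (hy : ∀ n : ℤ, δ ≤ |y - n|) :
    2 * δ ≤ |Real.sin (π * y)| := by
  have hround : |π * (y - round y)| ≤ π / 2 := by
    rw [abs_mul, abs_of_pos Real.pi_pos, div_eq_mul_one_div]
    exact mul_le_mul_of_nonneg_left (abs_sub_round y) Real.pi_pos.le
  calc 2 * δ ≤ 2 * |y - round y| := by gcongr; exact hy _
    _ = 2 / π * |π * (y - round y)| := by
        rw [abs_mul, abs_of_pos Real.pi_pos]
        field_simp
    _ ≤ |Real.sin (π * (y - round y))| := Real.mul_abs_le_abs_sin hround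
    _ = |Real.sin (π * y)| := by
        rw [mul_sub, mul_comm π (round y : ℝ), Real.sin_sub_int_mul_pi, abs_mul, abs_zpow,
          abs_neg, abs_one, one_zpow, one_mul]

lemma abs_sin_mul_le_norm_one_sub (r θ : ℝ) :
    |Real.sin θ| * (1 + r) ≤ ‖1 - r * exp ((2 * θ : ℝ) * I)‖ := by
  refine abs_le_of_sq_le_sq' ?_ (norm_nonneg _) |>.2
  have hcos := sq_nonneg (Real.cos θ * (1 - r))
  rw [Complex.sq_norm, normSq_apply, mul_pow, sq_abs]
  simp only [sub_re, one_re, sub_im, one_im, re_ofReal_mul, im_ofReal_mul, exp_ofReal_mul_I_re,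
    exp_ofReal_mul_I_im, Real.sin_two_mul, Real.cos_two_mul']
  refine sub_nonneg.1 (hcos.trans_eq ?_)
  linear_combination -(r ^ 2 * (Real.sin θ ^ 2 + Real.cos θ ^ 2) - 1) * Real.sin_sq_add_cos_sq θ

lemma norm_exp_neg_ofReal_mul (a : ℝ) (s : ℂ) : ‖exp (-(a * s))‖ = Real.exp (-(a * s.re)) := by
  simp [norm_exp]

lemma norm_inv_one_sub_exp_le_of_gap (hδ : 0 < δ) (hgap : ∀ n : ℤ, δ ≤ |R * a - n|)
    (ht : |t| = 2 * π * R) :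
    ‖(1 - exp (-(a * (x + t * I))))⁻¹‖ ≤ (2 * δ)⁻¹ * Real.exp (a * x) := by
  have hexp : exp (-(a * (x + t * I))) =
      (Real.exp (-(a * x)) : ℝ) * exp ((2 * -(a * t / 2) : ℝ) * I) := by
    rw [ofReal_exp, ← exp_add]
    congr 1
    push_cast
    ring
  have hsin : |Real.sin (-(a * t / 2))| = |Real.sin (π * (R * a))| := by
    rw [Real.sin_neg, abs_neg, show π * (R * a) = a * (2 * π * R) / 2 by ring]
    obtain h | h := abs_eq_abs.1 (ht.trans (abs_of_nonneg (ht ▸ abs_nonneg t)).symm) <;>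
      simp [h, neg_div]
  have hbound : 2 * δ * Real.exp (-(a * x)) ≤ ‖1 - exp (-(a * (x + t * I)))‖ := by
    rw [hexp]
    refine le_trans ?_ (abs_sin_mul_le_norm_one_sub _ _)
    rw [hsin]
    gcongr
    · exact two_mul_le_abs_sin_pi_mul hgap
    · exact le_add_of_nonneg_left zero_le_one
  calc _ = ‖1 - exp (-(a * (x + t * I)))‖⁻¹ := norm_inv _
    _ ≤ (2 * δ * Real.exp (-(a * x)))⁻¹ := by gcongr
    _ = _ := by rw [mul_inv, ← Real.exp_neg, neg_neg]

lemma norm_inv_one_sub_exp_le_of_re_le (ha : 0 < a) (hs : s.re ≤ -1) :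
    ‖(1 - exp (-(a * s)))⁻¹‖ ≤ (1 - Real.exp (-a))⁻¹ * Real.exp (a * s.re) := by
  have ha' : 0 < 1 - Real.exp (-a) := by simpa using ha
  have hbound : (1 - Real.exp (-a)) * Real.exp (-(a * s.re)) ≤ ‖1 - exp (-(a * s))‖ := by
    rw [sub_mul, one_mul, ← Real.exp_add, norm_sub_rev]
    refine le_trans ?_ (norm_sub_norm_le _ _)
    rw [norm_exp_neg_ofReal_mul, norm_one]
    gcongr
    exact Real.one_le_exp (by nlinarith)
  calc _ = ‖1 - exp (-(a * s))‖⁻¹ := norm_inv _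
    _ ≤ ((1 - Real.exp (-a)) * Real.exp (-(a * s.re)))⁻¹ := by gcongr
    _ = _ := by rw [mul_inv, ← Real.exp_neg, neg_neg]

lemma norm_perronKernel_le {β C : ι → ℝ} {D : ℝ}
    (hC : ∀ i, ‖(1 - exp (-(α i * s)))⁻¹‖ ≤ C i * Real.exp (β i * s.re)) (hD : ‖s‖⁻¹ ≤ D) :
    ‖perronKernel α L s‖ ≤ D * (∏ i, C i) * Real.exp ((L + ∑ i, β i) * s.re) := by
  have hD₀ : 0 ≤ D := (inv_nonneg.2 (norm_nonneg s)).trans hD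
  calc ‖perronKernel α L s‖
      = Real.exp (L * s.re) * ‖s‖⁻¹ * ∏ i, ‖(1 - exp (-(α i * s)))⁻¹‖ := by
        simp [perronKernel, norm_exp, div_eq_mul_inv]
    _ ≤ Real.exp (L * s.re) * D * ∏ i, (C i * Real.exp (β i * s.re)) := by
        gcongr with i
        exact hC i
    _ = _ := by
        rw [Finset.prod_mul_distrib, ← Real.exp_sum, ← Finset.sum_mul, add_mul, Real.exp_add]
        ring

/-- The nonzero integers of absolute value at most `x`, the range of summation for the residues. -/
def nonzeroInts (x : ℝ) : Finset ℤ := (Finset.Icc ⌈-x⌉ ⌊x⌋).erase 0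

lemma mem_nonzeroInts : k ∈ nonzeroInts x ↔ k ≠ 0 ∧ |(k : ℝ)| ≤ x := by
  rw [nonzeroInts, Finset.mem_erase, Finset.mem_Icc, Int.ceil_le, Int.le_floor, abs_le]

lemma sum_nonzeroInts {M : Type*} [AddCommMonoid M] (g : ℤ → M) (x : ℝ) :
    ∑ k ∈ nonzeroInts x, g k = ∑ k ∈ Finset.Icc 1 ⌊x⌋₊, (g k + g (-k)) := by
  have hmem : ∀ k : ℤ, k ∈ nonzeroInts x ↔ k ≠ 0 ∧ k.natAbs ∈ Finset.Icc 1 ⌊x⌋₊ := fun k => by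
    rw [mem_nonzeroInts, Finset.mem_Icc, Nat.one_le_iff_ne_zero, Int.natAbs_ne_zero]
    refine and_congr_right fun hk => ?_
    rw [Nat.le_floor_iff' (Int.natAbs_ne_zero.2 hk), Nat.cast_natAbs, Int.cast_abs,
      and_iff_right hk]
  rw [Finset.sum_add_distrib, ← Finset.sum_filter_add_sum_filter_not (nonzeroInts x) (0 < ·)]
  congr 1
  · refine Finset.sum_nbij' Int.natAbs (↑·) ?_ ?_ ?_ ?_ ?_
    all_goals simp only [Finset.mem_filter, hmem, Finset.mem_Icc]
    all_goals grind
  · refine Finset.sum_nbij' Int.natAbs (fun n => -(n : ℤ)) ?_ ?_ ?_ ?_ ?_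
    all_goals simp only [Finset.mem_filter, hmem, Finset.mem_Icc]
    all_goals grind

lemma abs_perronPole_im (ha : 0 < a) (k : ℤ) : |(perronPole a k).im| = 2 * π * (|(k : ℝ)| / a) := by
  have : (perronPole a k).im = 2 * π * k / a := by simp [perronPole]
  rw [this, abs_div, abs_mul, abs_of_pos ha, abs_of_pos Real.two_pi_pos, mul_div_assoc]

lemma perronPole_mem_rectangle {u v : ℝ} (hu : u < 0) (hv : 0 < v) (ha : 0 < a)
    (hgap : ∀ n : ℤ, R * a ≠ n) (hk : k ∈ nonzeroInts (R * a)) :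
    perronPole a k ∈ Ioo u v ×ℂ Ioo (-(2 * π * R)) (2 * π * R) := by
  have hlt : |(k : ℝ)| < R * a := (mem_nonzeroInts.1 hk).2.lt_of_ne fun h =>
    hgap |k| (by rw [← h]; push_cast; rfl)
  have him : |(perronPole a k).im| < 2 * π * R := by
    rw [abs_perronPole_im ha]
    gcongr
    rwa [div_lt_iff₀ ha]
  have hre : (perronPole a k).re = 0 := by simp [perronPole]
  exact ⟨by simpa [hre] using ⟨hu, hv⟩, abs_lt.1 him⟩

lemma exists_mem_nonzeroInts_of_exp_eq_one (ha : 0 < a) (hs : s ≠ 0) (him : |s.im| ≤ 2 * π * R)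
    (h : exp (-(a * s)) = 1) : ∃ k ∈ nonzeroInts (R * a), s = perronPole a k := by
  obtain ⟨k, rfl⟩ := (exp_neg_mul_eq_one_iff ha.ne').1 h
  refine ⟨k, mem_nonzeroInts.2 ⟨?_, ?_⟩, rfl⟩
  · rintro rfl
    simp [perronPole] at hs
  · rw [abs_perronPole_im ha] at him
    exact (div_le_iff₀ ha).1 (le_of_mul_le_mul_left him Real.two_pi_pos)

theorem rectIntegral_perronKernel [DecidableEq ι] {u v : ℝ} (hα : ∀ i, 0 < α i)
    (hirr : Pairwise fun i j => Irrational (α i / α j)) (L : ℝ) (hR : 0 < R)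
    (hgap : ∀ i, ∀ n : ℤ, R * α i ≠ n) (hu : u < 0) (hv : 0 < v) :
    rectIntegral (perronKernel α L) u v (-(2 * π * R)) (2 * π * R) =
      2 * π * I * (toddPolynomial α L +
        ∑ i, ∑ k ∈ nonzeroInts (R * α i), perronResidue α L i k) := by
  set J : Finset (Option (Σ _ : ι, ℤ)) :=
    Finset.insertNone (Finset.univ.sigma fun i => nonzeroInts (R * α i)) with hJ
  have hmem : ∀ i k, some ⟨i, k⟩ ∈ J ↔ k ∈ nonzeroInts (R * α i) := fun i k => by simp [hJ]
  let w : Option (Σ _ : ι, ℤ) → ℂ := fun o => o.elim 0 fun p => perronPole (α p.1) p.2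
  let r : Option (Σ _ : ι, ℤ) → ℂ :=
    fun o => o.elim (toddPolynomial α L : ℂ) fun p => perronResidue α L p.1 p.2
  have hk₀ : ∀ {i k}, some (⟨i, k⟩ : Σ _ : ι, ℤ) ∈ J → k ≠ 0 := fun h =>
    (mem_nonzeroInts.1 ((hmem _ _).1 h)).1
  have hpole : ∀ {i k}, some (⟨i, k⟩ : Σ _ : ι, ℤ) ∈ J → perronPole (α i) k ≠ 0 := fun h =>
    perronPole_ne_zero (hα _).ne' (hk₀ h)
  have hT : 0 < 2 * π * R := by positivity
  have hsum := rectIntegral_eq_sum_residues (f := perronKernel α L) J (w := w) (r := r)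
    (hu.trans hv).le (neg_lt_self hT).le ?_ ?_ ?_ ?_
  · rw [hsum, hJ, Finset.sum_insertNone, Finset.sum_sigma]
    rfl
  · rintro (_ | ⟨i, k⟩) h
    · exact ⟨⟨hu, hv⟩, neg_lt_zero.2 hT, hT⟩
    · exact perronPole_mem_rectangle hu hv (hα i) (hgap i) ((hmem i k).1 h)
  · rintro (_ | ⟨i, k⟩) hp (_ | ⟨j, l⟩) hq h
    · rfl
    · exact absurd h.symm (hpole hq)
    · exact absurd h (hpole hp)
    · obtain ⟨rfl, rfl⟩ := eq_and_eq_of_perronPole_eq hα hirr (hk₀ hp) h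
      rfl
  · intro s hs hsw
    have hs₀ : s ≠ 0 := hsw none (by simp [hJ])
    refine differentiableAt_perronKernel L hs₀ fun i hi => ?_
    obtain ⟨k, hk, hsk⟩ :=
      exists_mem_nonzeroInts_of_exp_eq_one (hα i) hs₀ (abs_le.2 hs.2) hi
    exact hsw (some ⟨i, k⟩) ((hmem i k).2 hk) hsk
  · rintro (_ | ⟨i, k⟩) h
    · exact hasResidueAt_perronKernel_zero (fun i => (hα i).ne') L
    · exact hasResidueAt_perronKernel hα hirr L i (hk₀ h)

/-- `R → ∞` in such a manner that every `R αᵢ` stays at distance at least `δ` from the integers,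
so that the horizontal lines `|Im s| = 2πR` stay away from the poles of the Perron kernel. -/
def gapAtTop {ι : Type*} (α : ι → ℝ) (δ : ℝ) : Filter ℝ :=
  atTop ⊓ 𝓟 {R | ∀ i, ∀ n : ℤ, δ ≤ |R * α i - n|}

theorem tendsto_sum_perronResidue_sub_lineIntegral [DecidableEq ι] (hα : ∀ i, 0 < α i)
    (hirr : Pairwise fun i j => Irrational (α i / α j)) (hL : 0 < L + ∑ i, α i) (hδ : 0 < δ) :
    Tendsto (fun R => 2 * π * (toddPolynomial α L +
        ∑ i, ∑ k ∈ nonzeroInts (R * α i), perronResidue α L i k) -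
      lineIntegral (perronKernel α L) (2 * π * R)) (gapAtTop α δ) (𝓝 0) := by
  set A := L + ∑ i, α i
  set C : ℝ := ∏ _i : ι, (2 * δ)⁻¹
  have hlim : Tendsto (fun R : ℝ => 2 * ((2 * π * R)⁻¹ * C * (Real.exp A / A))) (gapAtTop α δ)
      (𝓝 0) := by
    have hinv := tendsto_inv_atTop_zero.comp (tendsto_id.const_mul_atTop Real.two_pi_pos)
    refine Tendsto.mono_left ?_ inf_le_left
    simpa using ((hinv.mul_const C).mul_const (Real.exp A / A)).const_mul 2
  refine squeeze_zero_norm' ?_ hlim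
  filter_upwards [mem_inf_of_right (mem_principal_self _),
    mem_inf_of_left (eventually_gt_atTop 0)] with R hgap hR
  have hT : 0 < 2 * π * R := by positivity
  have hre : ∀ x y : ℝ, (x + y * I : ℂ).re = x := by simp
  refine norm_sub_lineIntegral_le (M' := 1 * ∏ i, (1 - Real.exp (-α i))⁻¹) hL hT.le
    (fun x t ht => ?_) (fun x y hx => ?_) (fun x hx => ?_)
  · have h := norm_perronKernel_le (α := α) (β := α) (L := L) (s := x + t * I)
      (C := fun _ => (2 * δ)⁻¹) (D := (2 * π * R)⁻¹)
      (fun i => by simpa using norm_inv_one_sub_exp_le_of_gap (x := x) hδ (hgap i) ht)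
      (inv_anti₀ hT (by simpa [ht] using abs_im_le_norm (x + t * I)))
    rwa [hre] at h
  · have h1 : 1 ≤ ‖(x + y * I : ℂ)‖ := by
      have := abs_re_le_norm (x + y * I)
      rw [hre] at this
      linarith [neg_le_abs x]
    have h := norm_perronKernel_le (α := α) (β := α) (L := L) (s := x + y * I)
      (fun i => norm_inv_one_sub_exp_le_of_re_le (hα i) ((hre x y).trans_le hx))
      (inv_le_one_of_one_le₀ h1)
    rwa [hre] at h
  · rw [rectIntegral_perronKernel hα hirr L hR (fun i n h => ?_) (by linarith) one_pos]
    · ring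
    · have := hgap i n
      rw [h, sub_self, abs_zero] at this
      linarith

end PerronKernelResidues

section Perron

variable {ι : Type*} [Fintype ι] {α : ι → ℝ} {L a : ℝ} {s : ℂ}

lemma lineIntegral_inv (T : ℝ) : lineIntegral (fun s => s⁻¹) T = (2 * Real.arctan T : ℝ) := by
  have hslit : ∀ y : ℝ, ((1 : ℝ) + y * I : ℂ) ∈ slitPlane := fun y => Or.inl (by simp)
  have hint := I_mul_verticalIntegral_eq_sub_of_hasDerivAt (b := -T) (t := T) (x := 1)
    (fun y _ => hasDerivAt_log (hslit y)) (intervalIntegrable_one_add_mul_I fun s hs =>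
      differentiableAt_inv (by rintro rfl; simp at hs))
  have hconj : ((1 : ℝ) + (-T : ℝ) * I : ℂ) = starRingEnd ℂ ((1 : ℝ) + T * I) := by simp
  have harg : arg ((1 : ℝ) + T * I) = Real.arctan T := by
    have h := Complex.abs_arg_lt_pi_div_two_iff.2
      (Or.inl (by simp) : 0 < ((1 : ℝ) + T * I : ℂ).re ∨ _)
    rw [← Real.arctan_tan (abs_lt.1 h).1 (abs_lt.1 h).2, tan_arg]
    simp
  rw [hconj, log_conj _ (slitPlane_arg_ne_pi (hslit T)), sub_conj, log_im, harg, mul_comm] at hint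
  exact mul_right_cancel₀ I_ne_zero hint

lemma tendsto_lineIntegral_exp_div (L : ℝ) :
    Tendsto (lineIntegral fun s => exp (L * s) / s) atTop (𝓝 (π * (1 + Real.sign L) : ℝ)) := by
  obtain hL | rfl | hL := lt_trichotomy L 0
  · rw [Real.sign_of_neg hL, add_neg_cancel, mul_zero, ofReal_zero]
    refine tendsto_lineIntegral_zero (B := -L) (M := 1) (neg_pos.2 hL) (fun s hs => ?_)
      fun s _ => ?_
    · have : s ≠ 0 := by rintro rfl; simp at hs; linarith
      fun_prop (disch := assumption)
    · simp [norm_exp, div_eq_inv_mul]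
  · have hlim := (Real.tendsto_arctan_atTop.mono_right nhdsWithin_le_nhds).const_mul 2
    rw [mul_div_cancel₀ _ two_ne_zero] at hlim
    have hinv : lineIntegral (fun s => exp ((0 : ℝ) * s) / s) =
        fun T => ((2 * Real.arctan T : ℝ) : ℂ) := by
      funext T
      rw [← lineIntegral_inv]
      simp
    rw [hinv, Real.sign_zero, add_zero, mul_one]
    exact (continuous_ofReal.tendsto _).comp hlim
  · rw [Real.sign_of_pos hL]
    have hpole := tendsto_sum_perronResidue_sub_lineIntegral (ι := Fin 0) (α := ![]) (L := L)
      (fun i => i.elim0) (fun i => i.elim0) (by simpa using hL) one_pos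
    have hgap : gapAtTop (![] : Fin 0 → ℝ) 1 = atTop := by simp [gapAtTop]
    have hkernel : perronKernel (![] : Fin 0 → ℝ) L = fun s => exp (L * s) / s := by
      funext s
      simp [perronKernel]
    have htodd : toddPolynomial (![] : Fin 0 → ℝ) L = 1 := by simp [toddPolynomial, toddSeries]
    rw [hgap, hkernel, htodd] at hpole
    have hscale : Tendsto (fun T : ℝ => T / (2 * π)) atTop atTop :=
      tendsto_id.atTop_div_const Real.two_pi_pos
    have hlim := (hpole.comp hscale).const_sub (2 * π : ℂ)
    simpa [Function.comp_def, mul_div_cancel₀ _ Real.two_pi_pos.ne', mul_comm (π : ℂ),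
      one_add_one_eq_two] using hlim

lemma norm_inv_one_sub_exp_le_of_le_re (ha : 0 < a) (hs : 1 ≤ s.re) :
    ‖(1 - exp (-(a * s)))⁻¹‖ ≤ (1 - Real.exp (-a))⁻¹ := by
  rw [norm_inv]
  refine inv_anti₀ (by simpa using ha) (le_trans ?_ (norm_sub_norm_le _ _))
  rw [norm_exp_neg_ofReal_mul, norm_one]
  gcongr
  exact le_mul_of_one_le_right ha.le hs

lemma perronKernel_eq_sum_add [DecidableEq ι] (P : ℕ) (L : ℝ) (h : ∀ i, exp (-(α i * s)) ≠ 1) :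
    perronKernel α L s =
      ∑ n ∈ Fintype.piFinset fun _ => Finset.range P, exp ((L - ∑ i, n i * α i : ℝ) * s) / s +
        perronKernel α L s * (1 - ∏ i, (1 + -exp (-(α i * s)) ^ P)) := by
  have hgeom : ∀ i, ∑ p ∈ Finset.range P, exp (-(α i * s)) ^ p =
      (1 - exp (-(α i * s)))⁻¹ * (1 + -exp (-(α i * s)) ^ P) := fun i => by
    rw [← sub_eq_add_neg, ← mul_neg_geom_sum, inv_mul_cancel_left₀ (sub_ne_zero.2 (h i).symm)]
  have hterm : ∀ n : ι → ℕ, exp ((L - ∑ i, n i * α i : ℝ) * s) / s =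
      exp (L * s) / s * ∏ i, exp (-(α i * s)) ^ n i := fun n => by
    simp only [← exp_nat_mul, ← exp_sum]
    rw [div_mul_eq_mul_div, ← exp_add]
    congr 2
    push_cast
    rw [sub_mul, sub_eq_add_neg, Finset.sum_mul, ← Finset.sum_neg_distrib]
    congr 1
    exact Finset.sum_congr rfl fun i _ => by ring
  simp only [hterm]
  rw [← Finset.mul_sum, ← Finset.prod_univ_sum (fun _ => Finset.range P)
    fun i p => exp (-(α i * s)) ^ p]
  simp only [hgeom, Finset.prod_mul_distrib, perronKernel]
  ring

lemma norm_one_sub_prod_le {P : ℕ} {B : ℝ} (hP : ∀ i, B ≤ P * α i) (hB : 0 ≤ B)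
    (hs : 0 ≤ s.re) :
    ‖1 - ∏ i, (1 + -exp (-(α i * s)) ^ P)‖ ≤
      Fintype.card ι * Real.exp (Fintype.card ι) * Real.exp (-B * s.re) := by
  have hle : ∑ i, ‖-exp (-(α i * s)) ^ P‖ ≤ Fintype.card ι * Real.exp (-B * s.re) := by
    rw [← nsmul_eq_mul, ← Finset.card_univ, ← Finset.sum_const]
    refine Finset.sum_le_sum fun i _ => ?_
    rw [norm_neg, norm_pow, norm_exp_neg_ofReal_mul, ← Real.exp_nat_mul]
    refine Real.exp_le_exp.2 ?_
    nlinarith [mul_le_mul_of_nonneg_right (hP i) hs]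
  have hle' : Fintype.card ι * Real.exp (-B * s.re) ≤ Fintype.card ι :=
    mul_le_of_le_one_right (Nat.cast_nonneg _) (Real.exp_le_one_iff.2 (by nlinarith))
  have hexp : ∀ y : ℝ, Real.exp y - 1 ≤ y * Real.exp y := fun y => by
    have := mul_le_mul_of_nonneg_right (Real.one_sub_le_exp_neg y) (Real.exp_nonneg y)
    rw [← Real.exp_add, neg_add_cancel, Real.exp_zero] at this
    linarith
  rw [norm_sub_rev]
  calc _ ≤ Real.exp (∑ i, ‖-exp (-(α i * s)) ^ P‖) - 1 :=
        Finset.norm_prod_one_add_sub_one_le _ _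
    _ ≤ Real.exp (Fintype.card ι * Real.exp (-B * s.re)) - 1 := by gcongr
    _ ≤ Fintype.card ι * Real.exp (-B * s.re) *
        Real.exp (Fintype.card ι * Real.exp (-B * s.re)) := hexp _
    _ ≤ Fintype.card ι * Real.exp (-B * s.re) * Real.exp (Fintype.card ι) := by gcongr
    _ = _ := by ring

/-- The number of `n : ι → ℕ` with `∑ᵢ nᵢ αᵢ ≤ L`, where those with `∑ᵢ nᵢ αᵢ = L` count half. -/
def halfCount (α : ι → ℝ) (L : ℝ) : ℝ :=
  ({n : ι → ℕ | ∑ i, n i * α i ≤ L}.ncard + {n : ι → ℕ | ∑ i, n i * α i < L}.ncard) / 2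

lemma exists_forall_le_natCast_mul {ι : Type*} [Finite ι] {α : ι → ℝ} (hα : ∀ i, 0 < α i)
    (L : ℝ) : ∃ P : ℕ, ∀ i, L ≤ P * α i := by
  obtain ⟨P, hP⟩ := Finite.exists_le fun i => ⌈L / α i⌉₊
  exact ⟨P, fun i => (div_le_iff₀ (hα i)).1 (Nat.ceil_le.1 (hP i))⟩

lemma mem_piFinset_range_of_sum_mul_le [DecidableEq ι] {P : ℕ} {n : ι → ℕ} (hα : ∀ i, 0 < α i)
    (hP : ∀ i, L < P * α i) (hn : ∑ i, n i * α i ≤ L) :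
    n ∈ Fintype.piFinset fun _ : ι => Finset.range P := by
  refine Fintype.mem_piFinset.2 fun i => Finset.mem_range.2 ?_
  have hi : n i * α i ≤ L := hn.trans' <| Finset.single_le_sum (f := fun i => n i * α i)
    (fun j _ => mul_nonneg (Nat.cast_nonneg _) (hα j).le) (Finset.mem_univ i)
  exact_mod_cast lt_of_mul_lt_mul_right (hi.trans_lt (hP i)) (hα i).le

lemma finite_setOf_sum_mul_le (hα : ∀ i, 0 < α i) (L : ℝ) :
    {n : ι → ℕ | ∑ i, n i * α i ≤ L}.Finite := by
  classical
  obtain ⟨P, hP⟩ := exists_forall_le_natCast_mul hα (L + 1)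
  exact (Finset.finite_toSet _).subset fun n hn =>
    mem_piFinset_range_of_sum_mul_le hα (fun i => (lt_add_one L).trans_le (hP i)) hn

lemma halfCount_eq_ncard_sub (hα : ∀ i, 0 < α i) (L : ℝ) :
    halfCount α L = {n : ι → ℕ | ∑ i, n i * α i ≤ L}.ncard -
      1 / 2 * {n : ι → ℕ | ∑ i, n i * α i = L}.ncard := by
  have hfin := finite_setOf_sum_mul_le hα L
  have hsplit := Set.ncard_union_eq (s := {n : ι → ℕ | ∑ i, n i * α i < L})
    (t := {n : ι → ℕ | ∑ i, n i * α i = L}) (disjoint_left.2 fun n hlt heq => hlt.ne heq)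
    (hfin.subset fun n hlt => mem_ofPred.2 (le_of_lt hlt))
    (hfin.subset fun n heq => mem_ofPred.2 (le_of_eq heq))
  simp only [← ofPred_or, ← le_iff_lt_or_eq] at hsplit
  rw [halfCount, hsplit]
  push_cast
  ring

lemma sum_sign_eq_halfCount [DecidableEq ι] {P : ℕ} (hα : ∀ i, 0 < α i) (hP : ∀ i, L < P * α i) :
    ∑ n ∈ Fintype.piFinset fun _ : ι => Finset.range P, (1 + Real.sign (L - ∑ i, n i * α i)) =
      2 * halfCount α L := by
  have hcard : ∀ p : (ι → ℕ) → Prop, [DecidablePred p] → (∀ n, p n → ∑ i, n i * α i ≤ L) →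
      ({n | p n}.ncard : ℝ) =
        ∑ n ∈ Fintype.piFinset fun _ : ι => Finset.range P, if p n then 1 else 0 :=
    fun p _ hp => by
      rw [Finset.sum_boole, ← Set.ncard_coe_finset, Finset.coe_filter]
      congr 2
      ext n
      simpa using fun hn => mem_piFinset_range_of_sum_mul_le hα hP (hp n hn)
  classical
  rw [halfCount, mul_div_cancel₀ _ two_ne_zero, hcard _ fun _ h => h, hcard _ fun _ => le_of_lt,
    ← Finset.sum_add_distrib]
  refine Finset.sum_congr rfl fun n _ => ?_
  obtain h | h | h := lt_trichotomy (∑ i, n i * α i) L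
  · rw [if_pos h, if_pos h.le, Real.sign_of_pos (sub_pos.2 h)]
  · rw [if_neg h.not_lt, if_pos h.le, h, sub_self, Real.sign_zero]
  · rw [if_neg h.le.not_gt, if_neg h.not_ge, Real.sign_of_neg (sub_neg.2 h)]
    norm_num

lemma exp_neg_mul_ne_one (ha : 0 < a) (hs : 0 < s.re) : exp (-(a * s)) ≠ 1 := fun h => by
  have hnorm := norm_exp_neg_ofReal_mul a s
  rw [h, norm_one, eq_comm, Real.exp_eq_one_iff, neg_eq_zero] at hnorm
  exact (mul_pos ha hs).ne' hnorm

lemma differentiableAt_perronKernel_of_re_pos (hα : ∀ i, 0 < α i) (L : ℝ) (hs : 0 < s.re) :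
    DifferentiableAt ℂ (perronKernel α L) s :=
  differentiableAt_perronKernel L (ne_zero_of_re_pos hs) fun i => exp_neg_mul_ne_one (hα i) hs

lemma tendsto_lineIntegral_perronKernel_mul {P : ℕ} (hα : ∀ i, 0 < α i)
    (hP : ∀ i, |L| + 1 ≤ P * α i) :
    Tendsto (lineIntegral fun s =>
      perronKernel α L s * (1 - ∏ i, (1 + -exp (-(α i * s)) ^ P))) atTop (𝓝 0) := by
  refine tendsto_lineIntegral_zero (B := 1) (M := (∏ i, (1 - Real.exp (-α i))⁻¹) *
    (Fintype.card ι * Real.exp (Fintype.card ι))) one_pos (fun s hs => ?_) fun s hs => ?_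
  · exact (differentiableAt_perronKernel_of_re_pos hα L (one_pos.trans_le hs)).mul (by fun_prop)
  have hexp : Real.exp (L * s.re) * Real.exp (-(|L| + 1) * s.re) ≤ Real.exp (-1 * s.re) := by
    rw [← Real.exp_add, ← add_mul]
    gcongr
    linarith [le_abs_self L]
  have hkernel : ‖perronKernel α L s‖ ≤
      ‖s‖⁻¹ * (∏ i, (1 - Real.exp (-α i))⁻¹) * Real.exp (L * s.re) := by
    simpa [-Finset.prod_inv_distrib] using norm_perronKernel_le (α := α) (β := 0) (L := L)
      (fun i => by simpa using norm_inv_one_sub_exp_le_of_le_re (hα i) hs) (le_refl ‖s‖⁻¹)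
  have hprod : 0 ≤ ∏ i, (1 - Real.exp (-α i))⁻¹ :=
    Finset.prod_nonneg fun i _ => inv_nonneg.2 (by simpa using (hα i).le)
  rw [norm_mul]
  calc _ ≤ ‖s‖⁻¹ * (∏ i, (1 - Real.exp (-α i))⁻¹) * Real.exp (L * s.re) *
        (Fintype.card ι * Real.exp (Fintype.card ι) * Real.exp (-(|L| + 1) * s.re)) := by
        gcongr
        exact norm_one_sub_prod_le hP (by positivity) (zero_le_one.trans hs)
    _ = ‖s‖⁻¹ * (∏ i, (1 - Real.exp (-α i))⁻¹) * (Fintype.card ι * Real.exp (Fintype.card ι)) *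
        (Real.exp (L * s.re) * Real.exp (-(|L| + 1) * s.re)) := by ring
    _ ≤ ‖s‖⁻¹ * (∏ i, (1 - Real.exp (-α i))⁻¹) * (Fintype.card ι * Real.exp (Fintype.card ι)) *
        Real.exp (-1 * s.re) := by gcongr
    _ = _ := by ring

theorem tendsto_lineIntegral_perronKernel (hα : ∀ i, 0 < α i) (L : ℝ) :
    Tendsto (lineIntegral (perronKernel α L)) atTop (𝓝 (2 * π * halfCount α L : ℝ)) := by
  classical
  obtain ⟨P, hP⟩ := exists_forall_le_natCast_mul hα (|L| + 1)
  set J := Fintype.piFinset fun _ : ι => Finset.range P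
  set F : (ι → ℕ) → ℂ → ℂ := fun n s => exp ((L - ∑ i, n i * α i : ℝ) * s) / s
  set G : ℂ → ℂ := fun s => perronKernel α L s * (1 - ∏ i, (1 + -exp (-(α i * s)) ^ P))
  have hre : ∀ s : ℂ, s.re = 1 → 0 < s.re := fun s hs => hs ▸ one_pos
  have hF : ∀ n s, s.re = 1 → DifferentiableAt ℂ (F n) s := fun n s hs => by
    have := ne_zero_of_re_pos (hre s hs)
    fun_prop (disch := assumption)
  have hG : ∀ s : ℂ, s.re = 1 → DifferentiableAt ℂ G s := fun s hs =>
    (differentiableAt_perronKernel_of_re_pos hα L (hre s hs)).mul (by fun_prop)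
  have hsplit : lineIntegral (perronKernel α L) =
      fun T => ∑ n ∈ J, lineIntegral (F n) T + lineIntegral G T := by
    funext T
    rw [← lineIntegral_sum J fun n _ => hF n,
      ← lineIntegral_add (fun s hs => DifferentiableAt.fun_sum fun n _ => hF n s hs) hG]
    exact lineIntegral_congr (fun s hs =>
      perronKernel_eq_sum_add P L fun i => exp_neg_mul_ne_one (hα i) (hre s hs)) T
  have hlim := (tendsto_finsetSum J fun n _ =>
    tendsto_lineIntegral_exp_div (L - ∑ i, n i * α i)).add
    (tendsto_lineIntegral_perronKernel_mul hα hP)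
  rw [add_zero, ← ofReal_sum, ← Finset.mul_sum, sum_sign_eq_halfCount hα fun i =>
    ((le_abs_self L).trans_lt (lt_add_one _)).trans_le (hP i), ← mul_assoc, mul_comm π] at hlim
  rwa [hsplit]

end Perron

section HalfCount

variable {ι : Type*} [Fintype ι] {α : ι → ℝ} {L a δ X : ℝ}

lemma perronResidue_neg [DecidableEq ι] (α : ι → ℝ) (L : ℝ) (i : ι) (k : ℤ) :
    perronResidue α L i (-k) = starRingEnd ℂ (perronResidue α L i k) := by
  have hpole : perronPole (α i) (-k) = starRingEnd ℂ (perronPole (α i) k) := by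
    simp [perronPole, neg_div, conj_ofNat]
  simp [perronResidue, hpole, map_prod, ← exp_conj, conj_ofNat]

/-- The contribution of the poles `± 2πik / αᵢ`, `1 ≤ k ≤ R αᵢ`, to the sum of the residues of the
Perron kernel. -/
def residueSum [DecidableEq ι] (α : ι → ℝ) (L : ℝ) (i : ι) (R : ℝ) : ℝ :=
  ∑ k ∈ Finset.Icc 1 ⌊R * α i⌋₊, 2 * (perronResidue α L i k).re

lemma sum_perronResidue [DecidableEq ι] (α : ι → ℝ) (L : ℝ) (i : ι) (R : ℝ) :
    ∑ k ∈ nonzeroInts (R * α i), perronResidue α L i k = residueSum α L i R := by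
  rw [sum_nonzeroInts, residueSum, ofReal_sum]
  exact Finset.sum_congr rfl fun k _ => by rw [perronResidue_neg, add_conj]

theorem tendsto_sum_residueSum [DecidableEq ι] (hα : ∀ i, 0 < α i)
    (hirr : Pairwise fun i j => Irrational (α i / α j)) (hL : 0 < L + ∑ i, α i) (hδ : 0 < δ) :
    Tendsto (fun R => ∑ i, residueSum α L i R) (gapAtTop α δ)
      (𝓝 (halfCount α L - toddPolynomial α L)) := by
  have hpoles := tendsto_sum_perronResidue_sub_lineIntegral hα hirr hL hδ
  have hline := (tendsto_lineIntegral_perronKernel hα L).comp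
    (tendsto_id.const_mul_atTop Real.two_pi_pos)
  have hlim := ((((continuous_re.tendsto _).comp hpoles).add
    ((continuous_re.tendsto _).comp (hline.mono_left inf_le_left))).div_const (2 * π)).sub_const
    (toddPolynomial α L)
  simp only [sum_perronResidue, ← ofReal_sum, ← ofReal_add] at hlim
  have hπ : 2 * π ≠ 0 := Real.two_pi_pos.ne'
  simpa [Function.comp_def, mul_div_cancel_left₀ _ hπ, re_ofReal_mul] using hlim

lemma gapAtTop_anti {κ μ : Type*} {α : μ → ℝ} {β : κ → ℝ} (h : range β ⊆ range α) (δ : ℝ) :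
    gapAtTop α δ ≤ gapAtTop β δ := by
  refine inf_le_inf_left _ (principal_mono.2 fun R hR j => ?_)
  obtain ⟨i, hi⟩ := h ⟨j, rfl⟩
  exact hi ▸ hR i

lemma volume_exists_abs_sub_lt_le (ha : 0 < a) (hδ : 0 < δ) (hδ₁ : δ ≤ 1) (hX : 0 ≤ X) :
    volume {R | R ∈ Icc 0 X ∧ ∃ n : ℤ, |R * a - n| < δ} ≤
      ENNReal.ofReal (2 * δ * X + 4 * δ / a) := by
  have hcover : {R | R ∈ Icc 0 X ∧ ∃ n : ℤ, |R * a - n| < δ} ⊆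
      ⋃ m ∈ Finset.range (⌊X * a⌋₊ + 2), Icc ((m - δ) / a) ((m + δ) / a) := by
    rintro R ⟨⟨h0, hRX⟩, n, hn⟩
    obtain ⟨hlt, hgt⟩ := abs_lt.1 hn
    have hRa : 0 ≤ R * a := by positivity
    have hRXa : R * a ≤ X * a := by gcongr
    have hn0 : -1 < n := by exact_mod_cast (by linarith : (-1 : ℝ) < n)
    lift n to ℕ using by lia
    rw [Int.cast_natCast] at hlt hgt
    have hlast : (n : ℝ) < (⌊X * a⌋₊ + 2 : ℕ) := by
      push_cast
      linarith [Nat.lt_floor_add_one (X * a)]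
    refine mem_iUnion₂.2 ⟨n, Finset.mem_range.2 (by exact_mod_cast hlast), ?_, ?_⟩
    · rw [div_le_iff₀ ha]
      linarith
    · rw [le_div_iff₀ ha]
      linarith
  have hvol : ∀ m : ℕ, volume (Icc ((m - δ) / a) ((m + δ) / a)) = ENNReal.ofReal (2 * δ / a) :=
    fun m => by
      rw [Real.volume_Icc]
      ring_nf
  calc _ ≤ ∑ m ∈ Finset.range (⌊X * a⌋₊ + 2), volume (Icc ((m - δ) / a) ((m + δ) / a)) :=
        (measure_mono hcover).trans (measure_biUnion_finset_le _ _)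
    _ = ENNReal.ofReal ((⌊X * a⌋₊ + 2) * (2 * δ / a)) := by
        simp only [hvol, Finset.sum_const, Finset.card_range, nsmul_eq_mul]
        rw [← ENNReal.ofReal_natCast, ← ENNReal.ofReal_mul (by positivity)]
        push_cast
        rfl
    _ ≤ ENNReal.ofReal ((X * a + 2) * (2 * δ / a)) := by
        gcongr
        exact Nat.floor_le (by positivity)
    _ = _ := by
        congr 1
        field_simp
        ring

-- Otherwise `[Y, X]` would be covered by sets of total measure at most
-- `2δ · card ι · X + O(1)`, which is less than `X - Y` for large `X`.
theorem neBot_gapAtTop (hα : ∀ i, 0 < α i) (hδ : 0 < δ) (hδ₁ : 2 * δ * Fintype.card ι < 1) :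
    (gapAtTop α δ).NeBot := by
  refine frequently_iff_neBot.1 (frequently_atTop.2 fun X₀ => ?_)
  by_contra! h
  set Y := max X₀ 0
  set S := ∑ i, 4 * δ / α i
  set X := (Y + S + 1) / (1 - 2 * δ * Fintype.card ι) with hX
  have hY : 0 ≤ Y := le_max_right _ _
  have hS : 0 ≤ S := Finset.sum_nonneg fun i _ => by have := hα i; positivity
  have hX₀ : 0 ≤ X := div_nonneg (by positivity) (sub_nonneg.2 hδ₁.le)
  rw [eq_div_iff (sub_pos.2 hδ₁).ne'] at hX
  have hcover : Icc Y X ⊆ ⋃ i, {R | R ∈ Icc 0 X ∧ ∃ n : ℤ, |R * α i - n| < δ} := fun R hR => by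
    obtain ⟨i, n, hn⟩ := h R ((le_max_left _ _).trans hR.1)
    exact mem_iUnion.2 ⟨i, ⟨hY.trans hR.1, hR.2⟩, n, hn⟩
  have hδ₂ : ∀ _ : ι, δ ≤ 1 := fun i => by
    have : (1 : ℝ) ≤ Fintype.card ι := by exact_mod_cast Fintype.card_pos_iff.2 ⟨i⟩
    nlinarith
  have hle : ENNReal.ofReal (X - Y) ≤ ENNReal.ofReal (∑ i, (2 * δ * X + 4 * δ / α i)) := by
    rw [← Real.volume_Icc, ENNReal.ofReal_sum_of_nonneg fun i _ => by have := hα i; positivity]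
    exact (measure_mono hcover).trans <| (measure_iUnion_fintype_le _ _).trans <|
      Finset.sum_le_sum fun i _ => volume_exists_abs_sub_lt_le (hα i) hδ (hδ₂ i) hX₀
  have hsum : ∑ i, (2 * δ * X + 4 * δ / α i) = 2 * δ * Fintype.card ι * X + S := by
    rw [Finset.sum_add_distrib, Finset.sum_const, Finset.card_univ, nsmul_eq_mul]
    ring
  rw [hsum, ENNReal.ofReal_le_ofReal_iff (by positivity)] at hle
  linarith

end HalfCount

section ResidueSums

variable {ι κ : Type*} [Fintype ι] [DecidableEq ι] [Fintype κ] [DecidableEq κ]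

lemma inv_one_sub_exp_neg_two_mul_I (θ : ℝ) :
    (1 - exp (-(2 * θ * I)))⁻¹ = exp (θ * I) / (2 * I * Real.sin θ) := by
  have hexp : 2 * I * Real.sin θ = exp (θ * I) * (1 - exp (-(2 * θ * I))) := by
    rw [ofReal_sin, mul_comm 2 I, mul_assoc, two_sin, mul_sub, ← exp_add]
    ring_nf
    simp
  rw [hexp, div_mul_cancel_left₀ (exp_ne_zero _)]

lemma perronResidue_eq (α : ι → ℝ) (L : ℝ) (i : ι) (k : ℤ) :
    perronResidue α L i k =
      exp ((2 * π * k * (L / α i) + ∑ j ∈ Finset.univ.erase i, π * k * α j / α i : ℝ) * I) /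
        ((2 * π * k * ∏ j ∈ Finset.univ.erase i, 2 * Real.sin (π * k * α j / α i) : ℝ) *
          I ^ Fintype.card ι) := by
  have hexp : L * perronPole (α i) k = (2 * π * k * (L / α i) : ℝ) * I := by
    rw [perronPole]
    push_cast
    ring
  have hfactor : ∀ j, (1 - exp (-(α j * perronPole (α i) k)))⁻¹ =
      exp ((π * k * α j / α i : ℝ) * I) / ((2 * Real.sin (π * k * α j / α i) : ℝ) * I) :=
    fun j => by
      rw [ofReal_mul, ofReal_ofNat, mul_right_comm 2, ← inv_one_sub_exp_neg_two_mul_I, perronPole]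
      congr 4
      push_cast
      ring
  have hcard : Fintype.card ι = (Finset.univ.erase i).card + 1 :=
    (Finset.card_erase_add_one (Finset.mem_univ i)).symm
  rw [perronResidue, hexp, Finset.prod_congr rfl fun j _ => hfactor j, Finset.prod_div_distrib,
    Finset.prod_mul_distrib, Finset.prod_const, hcard, pow_succ, ofReal_add, add_mul, exp_add,
    ofReal_sum, Finset.sum_mul, exp_sum, div_mul_div_comm]
  congr 1
  push_cast
  ring

lemma residueSum_comp_equiv (α : ι → ℝ) (e : κ ≃ ι) (L : ℝ) (j : κ) (R : ℝ) :
    residueSum (α ∘ e) L j R = residueSum α L (e j) R := by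
  have hprod : ∀ g : ι → ℂ, ∏ l ∈ Finset.univ.erase j, g (e l) =
      ∏ l ∈ Finset.univ.erase (e j), g l := fun g =>
    Finset.prod_nbij' e e.symm (by simp) (by simp [Equiv.symm_apply_eq]) (by simp) (by simp)
      (by simp)
  refine Finset.sum_congr rfl fun k _ => ?_
  rw [perronResidue, perronResidue, ← hprod]
  rfl

lemma residueSum_one (a L R : ℝ) :
    residueSum ![a] L 0 R =
      ∑ k ∈ Finset.Icc 1 ⌊R * a⌋₊, Real.sin (2 * π * k * (L / a)) / (π * k) := by
  refine Finset.sum_congr rfl fun k _ => ?_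
  rw [perronResidue_eq, show Finset.univ.erase (0 : Fin 1) = ∅ by decide,
    Fintype.card_fin, pow_one, ← div_div, div_I, neg_re, mul_I_re, neg_neg, div_ofReal_im,
    exp_ofReal_mul_I_im]
  simp only [Int.cast_natCast, Matrix.cons_val_fin_one, Finset.sum_empty, Finset.prod_empty,
    add_zero, mul_one]
  field_simp

lemma residueSum_two (a b L R : ℝ) :
    residueSum ![a, b] L 0 R =
      ∑ k ∈ Finset.Icc 1 ⌊R * a⌋₊, -(Real.cos (2 * π * k * (L / a) + π * k * b / a) /
        (2 * π * k * Real.sin (π * k * b / a))) := by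
  refine Finset.sum_congr rfl fun k _ => ?_
  rw [perronResidue_eq, show Finset.univ.erase (0 : Fin 2) = {1} by decide,
    Fintype.card_fin, I_sq, mul_neg_one, div_neg, neg_re, div_ofReal_re, exp_ofReal_mul_I_re]
  simp only [Int.cast_natCast, Matrix.cons_val_zero, Matrix.cons_val_one, Matrix.cons_val_fin_one,
    Finset.sum_singleton, Finset.prod_singleton, mul_neg, neg_inj]
  field_simp

lemma residueSum_three (a b c L R : ℝ) :
    residueSum ![a, b, c] L 0 R =
      ∑ k ∈ Finset.Icc 1 ⌊R * a⌋₊,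
        -(Real.sin (2 * π * k * (L / a) + (π * k * b / a + π * k * c / a)) /
          (4 * π * k * Real.sin (π * k * b / a) * Real.sin (π * k * c / a))) := by
  refine Finset.sum_congr rfl fun k _ => ?_
  rw [perronResidue_eq, show Finset.univ.erase (0 : Fin 3) = {1, 2} by decide,
    Fintype.card_fin, I_pow_three, mul_neg, div_neg, ← div_div, div_I, neg_neg, mul_I_re,
    div_ofReal_im, exp_ofReal_mul_I_im, Finset.sum_pair (by decide), Finset.prod_pair (by decide)]
  simp only [Int.cast_natCast, Matrix.cons_val_zero, Matrix.cons_val_one, Matrix.cons_val, mul_neg,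
    neg_inj]
  field_simp
  ring

end ResidueSums

section ToddPolynomial

variable {a L : ℝ}

lemma C_mul_rescale_bernoulli'PowerSeries (a : ℝ) :
    PowerSeries.C a⁻¹ * PowerSeries.rescale a (bernoulli'PowerSeries ℝ) =
      PowerSeries.mk fun n => a⁻¹ * (a ^ n * (bernoulli' n / n.factorial : ℚ)) := by
  ext n
  simp [bernoulli'PowerSeries]

lemma toddPolynomial_one (ha : a ≠ 0) (L : ℝ) : toddPolynomial ![a] L = L / a + 1 / 2 := by
  simp only [toddPolynomial, toddSeries, Fintype.card_fin, Fin.prod_univ_one,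
    Matrix.cons_val_fin_one, C_mul_rescale_bernoulli'PowerSeries, PowerSeries.coeff_mul,
    PowerSeries.coeff_mk, PowerSeries.coeff_rescale, PowerSeries.coeff_exp,
    Finset.Nat.sum_antidiagonal_eq_sum_range_succ_mk, Finset.sum_range_succ]
  simp only [Finset.range_zero, Finset.sum_empty, zero_add, tsub_zero, tsub_self,
    Nat.factorial, bernoulli'_zero, bernoulli'_one, eq_ratCast]
  push_cast
  field_simp
  ring

lemma toddPolynomial_three {a b c : ℝ} (ha : a ≠ 0) (hb : b ≠ 0) (hc : c ≠ 0) (L : ℝ) :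
    toddPolynomial ![a, b, c] L =
      L ^ 3 / (6 * a * b * c) + L ^ 2 / (4 * a * b) + L ^ 2 / (4 * a * c) + L ^ 2 / (4 * b * c)
      + L / (4 * a) + L / (4 * b) + L / (4 * c)
      + a * L / (12 * b * c) + b * L / (12 * a * c) + c * L / (12 * a * b)
      + a / (24 * b) + a / (24 * c) + b / (24 * a) + b / (24 * c) + c / (24 * a) + c / (24 * b)
      + 1 / 8 := by
  simp only [toddPolynomial, toddSeries, Fintype.card_fin, Fin.prod_univ_three,
    Matrix.cons_val, C_mul_rescale_bernoulli'PowerSeries, PowerSeries.coeff_mul,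
    PowerSeries.coeff_mk, PowerSeries.coeff_rescale, PowerSeries.coeff_exp,
    Finset.Nat.sum_antidiagonal_eq_sum_range_succ_mk, Finset.sum_range_succ]
  simp only [Finset.range_zero, Finset.sum_empty, Nat.succ_eq_add_one, zero_add, Nat.reduceAdd,
    Nat.reduceSub, tsub_zero, tsub_self, Nat.factorial, bernoulli'_zero, bernoulli'_one,
    bernoulli'_two, bernoulli'_three, eq_ratCast]
  push_cast
  field_simp
  ring

lemma halfCount_one (ha : 0 < a) (hL : 0 ≤ L) :
    halfCount ![a] L = L / a + 1 / 2 - B1star (L / a) := by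
  have hncard : ∀ p : ℕ → Prop, {n : Fin 1 → ℕ | p (n 0)}.ncard = {m | p m}.ncard := fun p =>
    Set.ncard_preimage_of_injective_subset_range (f := fun n : Fin 1 → ℕ => n 0) (s := {m | p m})
      (fun m n h => funext fun i => by rwa [Fin.fin_one_eq_zero i]) fun m _ => ⟨fun _ => m, rfl⟩
  have hle : {m : ℕ | m * a ≤ L}.ncard = ⌊L / a⌋₊ + 1 := by
    rw [← Nat.card_Iic, ← Set.ncard_coe_finset]
    congr 1
    ext m
    simp [Nat.le_floor_iff (div_nonneg hL ha.le), le_div_iff₀ ha]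
  have hlt : {m : ℕ | m * a < L}.ncard = ⌈L / a⌉₊ := by
    rw [← Finset.card_range ⌈L / a⌉₊, ← Set.ncard_coe_finset]
    congr 1
    ext m
    simp [Nat.lt_ceil, lt_div_iff₀ ha]
  have hcount : halfCount ![a] L = (⌊L / a⌋₊ + 1 + ⌈L / a⌉₊) / 2 := by
    simp only [halfCount, Fin.sum_univ_one, Matrix.cons_val_fin_one]
    rw [hncard fun m => m * a ≤ L, hncard fun m => m * a < L, hle, hlt]
    push_cast
    rfl
  rw [hcount, natCast_floor_eq_intCast_floor (div_nonneg hL ha.le),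
    natCast_ceil_eq_intCast_ceil (div_nonneg hL ha.le), B1star]
  split_ifs with h
  · obtain ⟨n, hn⟩ := h
    rw [hn, Int.floor_intCast, Int.ceil_intCast]
    ring
  · have hfract : Int.fract (L / a) ≠ 0 := fun h0 =>
      h ((Int.fract_eq_zero_iff.1 h0).imp fun _ => Eq.symm)
    rw [Int.ceil_eq_add_one_sub_fract hfract, Int.fract]
    ring

end ToddPolynomial

section TrigonometricSeries

variable {a b c L δ : ℝ}

/-- The partial sum of the cosine series of the pair of weights `a`, `b` at the poles with
denominator `a`; it is `cosSum` with `L`, `a`, `b` in place of the logarithms. -/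
def cosSeriesSum (L a b R : ℝ) : ℝ :=
  ∑ k ∈ Finset.Icc 1 ⌊R * a⌋₊,
    Real.cos (2 * π * k * ((L - 1 / 2 * b) / a)) / (k * Real.sin (π * k * b / a))

/-- The partial sum of the sine series of the triple of weights `a`, `b`, `c` at the poles with
denominator `a`; it is `sinSum` with `L`, `a`, `b`, `c` in place of the logarithms. -/
def sinSeriesSum (L a b c R : ℝ) : ℝ :=
  ∑ k ∈ Finset.Icc 1 ⌊R * a⌋₊,
    (Real.sin (2 * π * k * ((L + 1 / 2 * b - 1 / 2 * c) / a)) /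
      (k * Real.sin (π * k * b / a) * Real.sin (π * k * c / a)) +
     Real.sin (2 * π * k * ((L - 1 / 2 * b + 1 / 2 * c) / a)) /
      (k * Real.sin (π * k * b / a) * Real.sin (π * k * c / a)))

lemma sin_pi_mul_natCast_mul_div_ne_zero (hba : Irrational (b / a)) {k : ℕ} (hk : k ≠ 0) :
    Real.sin (π * k * b / a) ≠ 0 := by
  rw [Ne, Real.sin_eq_zero_iff]
  rintro ⟨n, hn⟩
  rw [mul_assoc, mul_div_assoc, mul_comm, mul_right_inj' Real.pi_ne_zero, mul_div_assoc] at hn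
  exact (hba.natCast_mul hk).ne_int n hn.symm

lemma cosSeriesSum_eq (hba : Irrational (b / a)) (L R : ℝ) :
    cosSeriesSum L a b R = 2 * π * (residueSum ![a] L 0 R - residueSum ![a, b] L 0 R) := by
  rw [residueSum_one, residueSum_two, ← Finset.sum_sub_distrib, Finset.mul_sum]
  refine Finset.sum_congr rfl fun k hk => ?_
  have hk₀ : k ≠ 0 := Nat.one_le_iff_ne_zero.1 (Finset.mem_Icc.1 hk).1
  have hsin := sin_pi_mul_natCast_mul_div_ne_zero hba hk₀
  have hk : (k : ℝ) ≠ 0 := Nat.cast_ne_zero.2 hk₀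
  have hangle : 2 * π * k * ((L - 1 / 2 * b) / a) = 2 * π * k * (L / a) - π * k * b / a := by ring
  rw [hangle, Real.cos_sub, Real.cos_add]
  field_simp
  ring

lemma sinSeriesSum_eq (hba : Irrational (b / a)) (hca : Irrational (c / a)) (L R : ℝ) :
    sinSeriesSum L a b c R = 4 * π * (residueSum ![a, b] L 0 R + residueSum ![a, c] L 0 R) -
      8 * π * residueSum ![a, b, c] L 0 R := by
  rw [residueSum_two, residueSum_two, residueSum_three, ← Finset.sum_add_distrib, Finset.mul_sum,
    Finset.mul_sum, ← Finset.sum_sub_distrib]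
  refine Finset.sum_congr rfl fun k hk => ?_
  have hk₀ : k ≠ 0 := Nat.one_le_iff_ne_zero.1 (Finset.mem_Icc.1 hk).1
  have hsin_b := sin_pi_mul_natCast_mul_div_ne_zero hba hk₀
  have hsin_c := sin_pi_mul_natCast_mul_div_ne_zero hca hk₀
  have hk : (k : ℝ) ≠ 0 := Nat.cast_ne_zero.2 hk₀
  have hangle : 2 * π * k * ((L + 1 / 2 * b - 1 / 2 * c) / a) =
      2 * π * k * (L / a) + (π * k * b / a - π * k * c / a) := by ring
  have hangle' : 2 * π * k * ((L - 1 / 2 * b + 1 / 2 * c) / a) =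
      2 * π * k * (L / a) - (π * k * b / a - π * k * c / a) := by ring
  rw [hangle, hangle']
  simp only [Real.sin_add, Real.sin_sub, Real.cos_add, Real.cos_sub]
  field_simp
  ring

/-- The excess of the half-weighted lattice point count over its polynomial main term. -/
def latticeDiscrepancy {ι : Type*} [Fintype ι] (α : ι → ℝ) (L : ℝ) : ℝ :=
  halfCount α L - toddPolynomial α L

lemma tendsto_residueSum_one (ha : 0 < a) (hL : 0 ≤ L) (hδ : 0 < δ) :
    Tendsto (residueSum ![a] L 0) (gapAtTop ![a] δ) (𝓝 (-B1star (L / a))) := by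
  have hlim := tendsto_sum_residueSum (α := ![a]) (L := L) (by simpa using ha)
    (Subsingleton.pairwise) (by simpa using by positivity) hδ
  rw [halfCount_one ha hL, toddPolynomial_one ha.ne'] at hlim
  simpa using hlim

lemma tendsto_residueSum_two (ha : 0 < a) (hb : 0 < b) (hab : Irrational (a / b)) (hL : 0 ≤ L)
    (hδ : 0 < δ) :
    Tendsto (fun R => residueSum ![a, b] L 0 R + residueSum ![b, a] L 0 R) (gapAtTop ![a, b] δ)
      (𝓝 (latticeDiscrepancy ![a, b] L)) := by
  have hba : Irrational (b / a) := by simpa using hab.inv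
  have hlim := tendsto_sum_residueSum (α := ![a, b]) (L := L) (by simp [Fin.forall_fin_two, ha, hb])
    (by simp [Pairwise, Fin.forall_fin_two, hab, hba])
    (by simpa [Fin.sum_univ_two] using by positivity) hδ
  refine hlim.congr fun R => ?_
  have hswap : ![a, b] ∘ Equiv.swap 0 1 = ![b, a] := by ext i; fin_cases i <;> rfl
  rw [Fin.sum_univ_two, ← hswap, residueSum_comp_equiv, Equiv.swap_apply_left]

lemma tendsto_residueSum_three (ha : 0 < a) (hb : 0 < b) (hc : 0 < c) (hab : Irrational (a / b))
    (hbc : Irrational (b / c)) (hac : Irrational (a / c)) (hL : 0 ≤ L) (hδ : 0 < δ) :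
    Tendsto (fun R => residueSum ![a, b, c] L 0 R + residueSum ![b, a, c] L 0 R +
        residueSum ![c, a, b] L 0 R) (gapAtTop ![a, b, c] δ)
      (𝓝 (latticeDiscrepancy ![a, b, c] L)) := by
  have hba : Irrational (b / a) := by simpa using hab.inv
  have hcb : Irrational (c / b) := by simpa using hbc.inv
  have hca : Irrational (c / a) := by simpa using hac.inv
  have hlim := tendsto_sum_residueSum (α := ![a, b, c]) (L := L)
    (by simp [Fin.forall_fin_succ, ha, hb, hc])
    (by simp [Pairwise, Fin.forall_fin_succ, hab, hba, hbc, hcb, hac, hca])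
    (by simpa [Fin.sum_univ_three] using by positivity) hδ
  refine hlim.congr fun R => ?_
  have hswap : ![a, b, c] ∘ Equiv.swap 0 1 = ![b, a, c] := by ext i; fin_cases i <;> rfl
  have hrotate : ![a, b, c] ∘ (finRotate 3).symm = ![c, a, b] := by ext i; fin_cases i <;> rfl
  rw [Fin.sum_univ_three, ← hswap, ← hrotate, residueSum_comp_equiv, residueSum_comp_equiv,
    Equiv.swap_apply_left]
  rfl

end TrigonometricSeries

section Limits

variable {a b c L δ : ℝ}

lemma tendsto_cosSeriesSum_add (ha : 0 < a) (hb : 0 < b) (hab : Irrational (a / b)) (hL : 0 ≤ L)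
    (hδ : 0 < δ) :
    Tendsto (fun R => cosSeriesSum L a b R + cosSeriesSum L b a R) (gapAtTop ![a, b] δ)
      (𝓝 (-(2 * π * (latticeDiscrepancy ![a, b] L + B1star (L / a) + B1star (L / b))))) := by
  have hba : Irrational (b / a) := by simpa using hab.inv
  have hone_a := (tendsto_residueSum_one ha hL hδ).mono_left
    (gapAtTop_anti (α := ![a, b]) (by simp) δ)
  have hone_b := (tendsto_residueSum_one hb hL hδ).mono_left
    (gapAtTop_anti (α := ![a, b]) (by simp) δ)
  have htwo := tendsto_residueSum_two ha hb hab hL hδ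
  convert ((hone_a.add hone_b).sub htwo).const_mul (2 * π) using 2 with R
  · rw [cosSeriesSum_eq hba, cosSeriesSum_eq hab]
    ring
  · ring

lemma tendsto_sinSeriesSum_add (ha : 0 < a) (hb : 0 < b) (hc : 0 < c) (hab : Irrational (a / b))
    (hbc : Irrational (b / c)) (hac : Irrational (a / c)) (hL : 0 ≤ L) (hδ : 0 < δ) :
    Tendsto (fun R => sinSeriesSum L a b c R + sinSeriesSum L b a c R + sinSeriesSum L c a b R)
      (gapAtTop ![a, b, c] δ)
      (𝓝 (4 * π * (latticeDiscrepancy ![a, b] L + latticeDiscrepancy ![b, c] L +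
        latticeDiscrepancy ![a, c] L) - 8 * π * latticeDiscrepancy ![a, b, c] L)) := by
  have hba : Irrational (b / a) := by simpa using hab.inv
  have hcb : Irrational (c / b) := by simpa using hbc.inv
  have hca : Irrational (c / a) := by simpa using hac.inv
  have htwo_ab := (tendsto_residueSum_two ha hb hab hL hδ).mono_left
    (gapAtTop_anti (α := ![a, b, c]) (by simp) δ)
  have htwo_bc := (tendsto_residueSum_two hb hc hbc hL hδ).mono_left
    (gapAtTop_anti (α := ![a, b, c]) (by simp [insert_subset_iff]) δ)
  have htwo_ac := (tendsto_residueSum_two ha hc hac hL hδ).mono_left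
    (gapAtTop_anti (α := ![a, b, c]) (by simp [insert_subset_iff]) δ)
  have hthree := tendsto_residueSum_three ha hb hc hab hbc hac hL hδ
  convert (((htwo_ab.add htwo_bc).add htwo_ac).const_mul (4 * π)).sub (hthree.const_mul (8 * π))
    using 2 with R
  rw [sinSeriesSum_eq hba hca, sinSeriesSum_eq hab hcb, sinSeriesSum_eq hac hbc]
  ring

theorem theorem7_general (ha : 0 < a) (hb : 0 < b) (hc : 0 < c) (hab : Irrational (a / b))
    (hbc : Irrational (b / c)) (hac : Irrational (a / c)) (hL : 0 ≤ L) :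
    ∃ Cab Cbc Cac S : ℝ,
      (∀ δ : ℝ, 0 < δ → δ < 1 / 6 →
        (gapAtTop ![a, b, c] δ).NeBot ∧
        Tendsto (fun R => cosSeriesSum L a b R + cosSeriesSum L b a R)
          (gapAtTop ![a, b, c] δ) (𝓝 Cab) ∧
        Tendsto (fun R => cosSeriesSum L b c R + cosSeriesSum L c b R)
          (gapAtTop ![a, b, c] δ) (𝓝 Cbc) ∧
        Tendsto (fun R => cosSeriesSum L a c R + cosSeriesSum L c a R)
          (gapAtTop ![a, b, c] δ) (𝓝 Cac) ∧
        Tendsto (fun R => sinSeriesSum L a b c R + sinSeriesSum L b a c R + sinSeriesSum L c a b R)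
          (gapAtTop ![a, b, c] δ) (𝓝 S)) ∧
      halfCount ![a, b, c] L = toddPolynomial ![a, b, c] L
        - B1star (L / a) - B1star (L / b) - B1star (L / c)
        - 1 / (4 * π) * Cab - 1 / (4 * π) * Cbc - 1 / (4 * π) * Cac - 1 / (8 * π) * S := by
  have hrange_ab : range ![a, b] ⊆ range ![a, b, c] := by simp
  have hrange_bc : range ![b, c] ⊆ range ![a, b, c] := by simp [insert_subset_iff]
  have hrange_ac : range ![a, c] ⊆ range ![a, b, c] := by simp [insert_subset_iff]
  refine ⟨_, _, _, _, fun δ hδ hδ₁ => ⟨neBot_gapAtTop (by simp [Fin.forall_fin_succ, ha, hb, hc]) hδ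
      (by norm_num; linarith),
    (tendsto_cosSeriesSum_add ha hb hab hL hδ).mono_left (gapAtTop_anti hrange_ab δ),
    (tendsto_cosSeriesSum_add hb hc hbc hL hδ).mono_left (gapAtTop_anti hrange_bc δ),
    (tendsto_cosSeriesSum_add ha hc hac hL hδ).mono_left (gapAtTop_anti hrange_ac δ),
    tendsto_sinSeriesSum_add ha hb hc hab hbc hac hL hδ⟩, ?_⟩
  rw [latticeDiscrepancy.eq_def ![a, b, c]]
  field_simp
  ring

end Limits

section Monomials

variable {a b c : ℕ} {x δ : ℝ}

lemma irrational_log_div_log (ha : 1 < a) (hb : 1 < b) (h : ∀ m n : ℕ, a ^ m = b ^ n → m = 0) :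
    Irrational (Real.log a / Real.log b) := by
  have hlog_a : 0 < Real.log a := Real.log_pos (Nat.one_lt_cast.2 ha)
  have hlog_b : 0 < Real.log b := Real.log_pos (Nat.one_lt_cast.2 hb)
  rintro ⟨q, hq⟩
  have hq₀ : 0 < q := by exact_mod_cast hq ▸ div_pos hlog_a hlog_b
  have hpow : a ^ q.den = b ^ q.num.natAbs := by
    rw [← Nat.cast_inj (R := ℝ)]
    push_cast
    refine Real.log_injOn_pos (mem_Ioi.2 (by positivity)) (mem_Ioi.2 (by positivity)) ?_
    have hnum : (q.num.natAbs : ℝ) = q * q.den := by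
      rw [Nat.cast_natAbs, abs_of_pos (Rat.num_pos.2 hq₀)]
      exact_mod_cast (Rat.mul_den_eq_num q).symm
    rw [Real.log_pow, Real.log_pow, hnum, hq]
    field_simp
  exact q.den_ne_zero (h _ _ hpow)

lemma one_lt_of_injective_pow (h : Function.Injective fun n : ℕ => a ^ n) : 1 < a := by
  by_contra! ha
  refine absurd (@h 1 2 ?_) (by norm_num)
  interval_cases a <;> rfl

lemma one_lt_of_injective
    (hind : Function.Injective fun t : ℕ × ℕ × ℕ => a ^ t.1 * b ^ t.2.1 * c ^ t.2.2) :
    1 < a ∧ 1 < b ∧ 1 < c := by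
  refine ⟨one_lt_of_injective_pow fun m n h => ?_, one_lt_of_injective_pow fun m n h => ?_,
    one_lt_of_injective_pow fun m n h => ?_⟩
  · simpa using @hind (m, 0, 0) (n, 0, 0) (by simpa using h)
  · simpa using @hind (0, m, 0) (0, n, 0) (by simpa using h)
  · simpa using @hind (0, 0, m) (0, 0, n) (by simpa using h)

lemma irrational_log_div_log_of_injective
    (hind : Function.Injective fun t : ℕ × ℕ × ℕ => a ^ t.1 * b ^ t.2.1 * c ^ t.2.2) :
    Irrational (Real.log a / Real.log b) ∧ Irrational (Real.log b / Real.log c) ∧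
      Irrational (Real.log a / Real.log c) := by
  obtain ⟨ha, hb, hc⟩ := one_lt_of_injective hind
  refine ⟨irrational_log_div_log ha hb fun m n h => ?_,
    irrational_log_div_log hb hc fun m n h => ?_, irrational_log_div_log ha hc fun m n h => ?_⟩
  · exact congrArg Prod.fst (@hind (m, 0, 0) (0, n, 0) (by simpa using h))
  · exact congrArg (fun t => t.2.1) (@hind (0, m, 0) (0, 0, n) (by simpa using h))
  · exact congrArg Prod.fst (@hind (m, 0, 0) (0, 0, n) (by simpa using h))

lemma gapFilter_eq_gapAtTop (a b c : ℕ) (δ : ℝ) :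
    gapFilter a b c δ = gapAtTop ![Real.log a, Real.log b, Real.log c] δ := by
  simp [gapFilter, gapAtTop, Fin.forall_fin_succ, forall_and]

lemma ncard_sum_mul_log (ha : 0 < a) (hb : 0 < b) (hc : 0 < c) (p : ℝ → Prop) :
    {n : Fin 3 → ℕ | p (∑ i, n i * ![Real.log a, Real.log b, Real.log c] i)}.ncard =
      {t : ℕ × ℕ × ℕ | p (Real.log (a ^ t.1 * b ^ t.2.1 * c ^ t.2.2))}.ncard := by
  have hlog : ∀ n : Fin 3 → ℕ, Real.log (a ^ n 0 * b ^ n 1 * c ^ n 2) =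
      ∑ i, n i * ![Real.log a, Real.log b, Real.log c] i := fun n => by
    rw [Real.log_mul (by positivity) (by positivity), Real.log_mul (by positivity) (by positivity),
      Real.log_pow, Real.log_pow, Real.log_pow, Fin.sum_univ_three]
    rfl
  simp only [← hlog]
  refine Set.ncard_preimage_of_injective_subset_range
    (f := fun n : Fin 3 → ℕ => (n 0, n 1, n 2))
    (s := {t | p (Real.log (a ^ t.1 * b ^ t.2.1 * c ^ t.2.2))})
    (fun m n h => ?_) fun t _ => ⟨![t.1, t.2.1, t.2.2], rfl⟩
  simp only [Prod.mk.injEq] at h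
  ext i
  fin_cases i
  exacts [h.1, h.2.1, h.2.2]

lemma chiS_eq_ncard
    (hind : Function.Injective fun t : ℕ × ℕ × ℕ => a ^ t.1 * b ^ t.2.1 * c ^ t.2.2) (x : ℝ) :
    chiS a b c x =
      {t : ℕ × ℕ × ℕ | (a : ℝ) ^ t.1 * (b : ℝ) ^ t.2.1 * (c : ℝ) ^ t.2.2 = x}.ncard := by
  by_cases hx : x ∈ smoothSet a b c
  · obtain ⟨p, q, l, rfl⟩ := id hx
    have hsingleton : {t : ℕ × ℕ × ℕ | (a : ℝ) ^ t.1 * (b : ℝ) ^ t.2.1 * (c : ℝ) ^ t.2.2 =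
        (a : ℝ) ^ p * (b : ℝ) ^ q * (c : ℝ) ^ l} = {(p, q, l)} := by
      ext t
      refine ⟨fun h => hind (by exact_mod_cast h), ?_⟩
      rintro rfl
      rfl
    rw [chiS, indicator_of_mem hx, hsingleton, ncard_singleton, Nat.cast_one]
  · rw [chiS, indicator_of_notMem hx, eq_comm, Nat.cast_eq_zero]
    refine (congrArg ncard (eq_empty_of_forall_notMem fun t ht => hx ?_)).trans (ncard_empty _)
    exact ⟨t.1, t.2.1, t.2.2, (mem_ofPred.1 ht).symm⟩

lemma countN_eq_halfCount_add
    (hind : Function.Injective fun t : ℕ × ℕ × ℕ => a ^ t.1 * b ^ t.2.1 * c ^ t.2.2) (hx : 0 < x) :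
    (countN a b c x : ℝ) =
      halfCount ![Real.log a, Real.log b, Real.log c] (Real.log x) + 1 / 2 * chiS a b c x := by
  obtain ⟨ha, hb, hc⟩ := one_lt_of_injective hind
  have hpos : ∀ t : ℕ × ℕ × ℕ, (0 : ℝ) < a ^ t.1 * b ^ t.2.1 * c ^ t.2.2 := fun t => by
    positivity
  have hlog : ∀ i, 0 < ![Real.log a, Real.log b, Real.log c] i := by
    simp [Fin.forall_fin_succ, Real.log_pos, ha, hb, hc]
  rw [halfCount_eq_ncard_sub hlog, ncard_sum_mul_log (by lia) (by lia) (by lia) (· ≤ Real.log x),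
    ncard_sum_mul_log (by lia) (by lia) (by lia) (· = Real.log x), chiS_eq_ncard hind, countN]
  simp only [Real.log_le_log_iff (hpos _) hx, Real.log_injOn_pos.eq_iff (hpos _) hx]
  ring

end Monomials

end

theorem theorem7 (a b c : ℕ) (hab : a < b) (hbc : b < c)
    (hgcd : Nat.gcd (Nat.gcd a b) c = 1)
    (hind : Function.Injective (fun t : ℕ × ℕ × ℕ => a ^ t.1 * b ^ t.2.1 * c ^ t.2.2))
    (x : ℝ) (hx : 1 ≤ x) :
    ∃ Cab Cbc Cac S : ℝ,
      (∀ δ : ℝ, 0 < δ → δ < 1 / 6 →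
        (gapFilter a b c δ).NeBot ∧
        Tendsto (fun R : ℝ => cosPairSum x a b R) (gapFilter a b c δ) (𝓝 Cab) ∧
        Tendsto (fun R : ℝ => cosPairSum x b c R) (gapFilter a b c δ) (𝓝 Cbc) ∧
        Tendsto (fun R : ℝ => cosPairSum x a c R) (gapFilter a b c δ) (𝓝 Cac) ∧
        Tendsto (fun R : ℝ => sinSum x a b c R + sinSum x b a c R + sinSum x c a b R)
          (gapFilter a b c δ) (𝓝 S)) ∧
      (countN a b c x : ℝ) =
        Real.log x ^ 3 / (6 * Real.log a * Real.log b * Real.log c)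
        + Real.log x ^ 2 / (4 * Real.log a * Real.log b)
        + Real.log x ^ 2 / (4 * Real.log a * Real.log c)
        + Real.log x ^ 2 / (4 * Real.log b * Real.log c)
        + Real.log x / (4 * Real.log a)
        + Real.log x / (4 * Real.log b)
        + Real.log x / (4 * Real.log c)
        + Real.log a * Real.log x / (12 * Real.log b * Real.log c)
        + Real.log b * Real.log x / (12 * Real.log a * Real.log c)
        + Real.log c * Real.log x / (12 * Real.log a * Real.log b)
        + Real.log a / (24 * Real.log b) + Real.log a / (24 * Real.log c)
        + Real.log b / (24 * Real.log a) + Real.log b / (24 * Real.log c)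
        + Real.log c / (24 * Real.log a) + Real.log c / (24 * Real.log b)
        + 1 / 8
        - B1star (Real.log x / Real.log a)
        - B1star (Real.log x / Real.log b)
        - B1star (Real.log x / Real.log c)
        - 1 / (4 * Real.pi) * Cab
        - 1 / (4 * Real.pi) * Cbc
        - 1 / (4 * Real.pi) * Cac
        - 1 / (8 * Real.pi) * S
        + 1 / 2 * chiS a b c x := by
  obtain ⟨ha, hb, hc⟩ := one_lt_of_injective hind
  obtain ⟨hirr_ab, hirr_bc, hirr_ac⟩ := irrational_log_div_log_of_injective hind
  have hlog : ∀ {n : ℕ}, 1 < n → 0 < Real.log n := fun hn => Real.log_pos (Nat.one_lt_cast.2 hn)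
  obtain ⟨Cab, Cbc, Cac, S, hlim, hcount⟩ := theorem7_general (hlog ha) (hlog hb) (hlog hc)
    hirr_ab hirr_bc hirr_ac (Real.log_nonneg hx)
  refine ⟨Cab, Cbc, Cac, S, fun δ => gapFilter_eq_gapAtTop a b c δ ▸ hlim δ, ?_⟩
  rw [countN_eq_halfCount_add hind (one_pos.trans_le hx), hcount,
    toddPolynomial_three (hlog ha).ne' (hlog hb).ne' (hlog hc).ne']
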